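/- A signed graph $(G,\Sigma^-)$ is a finite simple graph $G$ with a set $\Sigma^-$ of negative edges (the other edges are positive); its adjacency matrix has entry $1$, $-1$ or $0$ according to whether two vertices are joined by a positive edge, by a negative edge, or are not adjacent. If $\mu$ is an eigenvalue of multiplicity $k$, a star complement for $\mu$ is a signed subgraph obtained by deleting a set of $k$ vertices, such that $\mu$ is not an eigenvalue of it. Two signed graphs are switching isomorphic, written $\cong^s$, if one is isomorphic to $(G',\Sigma')$ with $A_{(G',\Sigma')}=D^{-1}AD$, where $A$ is the adjacency matrix of the other and $D$ is a diagonal matrix with diagonal entries $\pm1$. A signed graph is an $SRG^s(n,r,a,b,c)$ if it has $n$ vertices, its underlying graph is $r$-regular, it has at least one edge, it is not a complete graph with all edges of the same sign, and, writing $w_2(u,v)$ for the number of positive minus the number of negative walks of length $2$ from $u$ to $v$ (the sign of a walk being the product of the signs of its edges), $w_2(u,v)=a$ whenever $u,v$ are joined by a positive edge, $w_2(u,v)=b$ whenever they are joined by a negative edge, and $w_2(u,v)=c$ whenever $u\neq v$ are not adjacent. Let $\mathcal N(\mathcal H)$ be the set of natural numbers having at least one of the forms: (i) $2^p$ with $p\ge1$;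 (ii) $2^p(q^h+1)$ with $p\ge2$, $h\ge1$, $q$ prime; (iii) $2^pq(q+1)$ with $p\ge2$, $q\equiv3\pmod 4$ prime; (iv) $q+1$ with $q\equiv3\pmod4$ a prime power; (v) $2(q+1)$ with $q\equiv1\pmod4$ a prime power. Theorem. Let $\mu$ be a real number such that $\mu^2$ is an integer, and let $s=\mu^2+1\ge3$. Among the signed bipartite graphs that have a totally disconnected graph of order $s$ as a star complement for the eigenvalue $\mu$, there is one with the largest number of vertices. Let $\dot{\mathscr B}_m$ be any such graph with the largest number of vertices. (1) If $\mu^2\equiv2\pmod4$, then $\dot{\mathscr B}_m\cong^s(K_{2,\mu^2}\cup K_1,\,E(K_{1,\mu^2/2}))$, where the negative edges join one vertex of the part of size $2$ to $\mu^2/2$ vertices of the part of size $\mu^2$. (2) If $\mu^2\in\mathcal N(\mathcal H)$, then $\dot{\mathscr B}_m$ is switching isomorphic to the disjoint union of some $SRG^s(2\mu^2,\mu^2,0,0,0)$ and an isolated vertex $K_1$. (3) If $\mu^2$ is an odd prime power, then $\dot{\mathscr B}_m$ is switching isomorphic to some $SRG^s(2\mu^2+2,\mu^2,0,0,0)$.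 -/

import Mathlib

/-- A signed graph `(G, Σ⁻)` on the vertex set `V`: a simple graph together with its set of
negative edges. -/
structure SignedGraph (V : Type*) where
  graph : SimpleGraph V
  neg : Set (Sym2 V)
  neg_subset : neg ⊆ graph.edgeSet

namespace SignedGraph

/-- The simple graph `G` regarded as the signed graph `(G, ∅)`. -/
def ofSimple {V : Type*} (G : SimpleGraph V) : SignedGraph V where
  graph := G
  neg := ∅
  neg_subset := Set.empty_subset _

/-- `u` and `v` are joined by a positive edge. -/
def PosAdj {V : Type*} (G : SignedGraph V) (u v : V) : Prop :=
  G.graph.Adj u v ∧ s(u, v) ∉ G.neg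

/-- `u` and `v` are joined by a negative edge. -/
def NegAdj {V : Type*} (G : SignedGraph V) (u v : V) : Prop :=
  G.graph.Adj u v ∧ s(u, v) ∈ G.neg

open Classical in
/-- The adjacency matrix, with entries `1`, `-1`, `0`. -/
noncomputable def adjMatrix {V : Type*} (G : SignedGraph V) : Matrix V V ℤ :=
  Matrix.of fun u v => if G.PosAdj u v then 1 else if G.NegAdj u v then -1 else 0

/-- The adjacency matrix as an endomorphism of `ℝ^V`. -/
noncomputable def adjEnd {V : Type*} [Fintype V] (G : SignedGraph V) :
    Module.End ℝ (V → ℝ) :=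
  (G.adjMatrix.map (fun z : ℤ => (z : ℝ))).mulVecLin

/-- The signed subgraph induced by a set of vertices. -/
def induce {V : Type*} (G : SignedGraph V) (T : Set V) : SignedGraph T where
  graph := G.graph.induce T
  neg := {e | Sym2.map Subtype.val e ∈ G.neg}
  neg_subset := by
    intro e he
    induction e with
    | _ u v => exact G.neg_subset he

/-- The disjoint union of two signed graphs. -/
def disjUnion {V W : Type*} (G : SignedGraph V) (H : SignedGraph W) : SignedGraph (V ⊕ W) where
  graph := G.graph.sum H.graph
  neg := Sym2.map Sum.inl '' G.neg ∪ Sym2.map Sum.inr '' H.neg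
  neg_subset := by
    rintro e (⟨e, he, rfl⟩ | ⟨e, he, rfl⟩)
    · have h := G.neg_subset he
      induction e with
      | _ u v => simpa using h
    · have h := H.neg_subset he
      induction e with
      | _ u v => simpa using h

open Classical in
/-- `S` is a star set for the eigenvalue `μ` of `G`: the number of elements of `S` is the
multiplicity of `μ`, and `μ` is not an eigenvalue of `G - S`. The signed graph `G - S` is then a
star complement for `μ` in `G`. The adjacency matrix is real symmetric, so the multiplicity of `μ`
is the dimension of its eigenspace. -/
def IsStarSet {V : Type*} [Fintype V] (G : SignedGraph V) (μ : ℝ) (S : Finset V) : Prop :=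
  G.adjEnd.HasEigenvalue μ ∧
  S.card = Module.finrank ℝ (G.adjEnd.eigenspace μ) ∧
  ¬ (G.induce {v | v ∉ S}).adjEnd.HasEigenvalue μ

/-- `G` has a totally disconnected graph of order `s` as a star complement for the
eigenvalue `μ`. -/
def HasTotallyDisconnectedStarComplement {V : Type*} [Fintype V] (G : SignedGraph V)
    (μ : ℝ) (s : ℕ) : Prop :=
  ∃ S : Finset V, G.IsStarSet μ S ∧ (G.induce {v | v ∉ S}).graph = ⊥ ∧
    Nat.card {v // v ∉ S} = s

/-- `G` is a maximal signed bipartite graph with a totally disconnected graph of order `s` as a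
star complement for `μ`: it has the largest number of vertices among all such graphs. -/
def IsMaximalBipartite {V : Type*} [Fintype V] (G : SignedGraph V) (μ : ℝ) (s : ℕ) : Prop :=
  G.graph.IsBipartite ∧ G.HasTotallyDisconnectedStarComplement μ s ∧
  ∀ (n : ℕ) (G' : SignedGraph (Fin n)), G'.graph.IsBipartite →
    G'.HasTotallyDisconnectedStarComplement μ s → n ≤ Fintype.card V

/-- Isomorphism: a relabelling of the vertices carries one adjacency matrix to the other. -/
def IsIsomorphic {V W : Type*} (G : SignedGraph V) (H : SignedGraph W) : Prop :=
  ∃ e : V ≃ W, H.adjMatrix = Matrix.reindex e e G.adjMatrix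

/-- Switching equivalence: `A_H = D⁻¹ A_G D` for a diagonal matrix `D` with diagonal entries `±1`
(so that `D⁻¹ = D`), written entrywise. -/
def IsSwitchingEquivalent {V : Type*} (G H : SignedGraph V) : Prop :=
  ∃ d : V → ℤ, (∀ v, d v = 1 ∨ d v = -1) ∧
    ∀ u v, H.adjMatrix u v = d u * G.adjMatrix u v * d v

/-- `G` is isomorphic to a signed graph that is switching equivalent to `H`. -/
def IsSwitchingIsomorphic {V W : Type*} (G : SignedGraph V) (H : SignedGraph W) : Prop :=
  ∃ K : SignedGraph W, K.IsSwitchingEquivalent H ∧ G.IsIsomorphic K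

/-- The number of positive walks of length `2` from `u` to `v` minus the number of negative ones;
a walk is given by its middle vertex and its sign is the product of the signs of its edges. -/
noncomputable def w₂ {V : Type*} (G : SignedGraph V) (u v : V) : ℤ :=
  (Nat.card {w // G.adjMatrix u w * G.adjMatrix w v = 1} : ℤ) -
    (Nat.card {w // G.adjMatrix u w * G.adjMatrix w v = -1} : ℤ)

/-- Complete, with all edges of the same sign. -/
def IsHomogeneousComplete {V : Type*} (G : SignedGraph V) : Prop :=
  G.graph = ⊤ ∧ (G.neg = ∅ ∨ G.neg = G.graph.edgeSet)

open Classical in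
/-- `G` is a signed strongly regular graph with parameters `(n, r, a, b, c)`. -/
def IsSRG {V : Type*} [Fintype V] (G : SignedGraph V) (n r : ℕ) (a b c : ℤ) : Prop :=
  Fintype.card V = n ∧
  G.graph.IsRegularOfDegree r ∧
  ¬ G.IsHomogeneousComplete ∧
  G.graph ≠ ⊥ ∧
  (∀ u v, G.PosAdj u v → G.w₂ u v = a) ∧
  (∀ u v, G.NegAdj u v → G.w₂ u v = b) ∧
  (∀ u v, u ≠ v → ¬ G.graph.Adj u v → G.w₂ u v = c)

/-- The single vertex `(K₁, ∅)`. -/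
def K₁ : SignedGraph (Fin 1) := ofSimple ⊥

/-- The signed graph `(K_{2,m}, E(K_{1,m/2}))`: one of the two vertices of the part of size `2` is
joined by negative edges to `m/2` vertices of the other part, and all other edges are positive. -/
def signedK₂ (m : ℕ) : SignedGraph (Fin 2 ⊕ Fin m) where
  graph := completeBipartiteGraph (Fin 2) (Fin m)
  neg := {e | ∃ j : Fin m, (j : ℕ) < m / 2 ∧ e = s(Sum.inl 1, Sum.inr j)}
  neg_subset := by
    rintro e ⟨j, -, rfl⟩
    simp

end SignedGraph

/-- The set `𝒩(ℋ)`: the natural numbers that have at least one of five forms, each of which is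
classically the order of a Hadamard matrix. -/
def paleyHadamardOrders : Set ℕ :=
  {n | (∃ p, 1 ≤ p ∧ n = 2 ^ p) ∨
    (∃ p h q, 2 ≤ p ∧ 1 ≤ h ∧ q.Prime ∧ n = 2 ^ p * (q ^ h + 1)) ∨
    (∃ p q, 2 ≤ p ∧ q.Prime ∧ q % 4 = 3 ∧ n = 2 ^ p * q * (q + 1)) ∨
    (∃ q, IsPrimePow q ∧ q % 4 = 3 ∧ n = q + 1) ∨
    (∃ q, IsPrimePow q ∧ q % 4 = 1 ∧ n = 2 * (q + 1))}

open scoped Kronecker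

/-! ### Hadamard and conference matrices -/

/-! Write m = μ², let S be the star set, and let B be the block of the adjacency matrix A with rows
in S and columns in the star complement, so B has m + 1 columns. Since the star complement has no
edges, the reconstruction equation reads μ A_S + B Bᵀ = m I, where A_S is the block of A on S.
Bipartiteness forces A_S = 0: adjacent vertices of S would have disjoint neighbourhoods of size m
among m + 1 vertices, impossible for m ≥ 2. Hence B has entries 0, ±1 and orthogonal rows of weight
m (`IsStarSet.isWeighingSet`). Conversely every such B with at least one row yields a graph of the
required kind (`exists_isBipartite_of_partialWeighing`), so maximality means that B has as many rows
as possible, and rank bounds this number by m + 1.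

Each row of B has exactly one zero. If m is even, parity puts all the zeros in one column
(`zero_eq_of_even`), which is an isolated vertex; what remains is a ±1 matrix with orthogonal rows
of length m. So there are at most m rows, with equality when m is a Hadamard order, and only two
rows when 4 does not divide m (`four_dvd`). If m is an odd prime power, Paley's conference matrix
reaches m + 1 rows. When B, without its zero column if there is one, is square, its columns are
orthogonal too, so A² = m I off the isolated vertex, and that is the strongly regular condition with
a = b = c = 0.

It remains to see that every member of `paleyHadamardOrders` is a Hadamard order
(`isHadamardOrder_of_mem`). Kronecker products and the constructions of Paley and Williamson settle
all the forms except 2ᵖ(2ʰ + 1), which comes from Golay pairs in a Goethals–Seidel array. -/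

theorem Matrix.isHadamard_int {n : Type*} [Fintype n] [DecidableEq n] {H : Matrix n n ℤ}
    (hH : ∀ i j, H i j = 1 ∨ H i j = -1)
    (hmul : H * H.transpose = (Fintype.card n : ℤ) • (1 : Matrix n n ℤ)) : H.IsHadamard := by
  -- The criterion used below needs the order to be a regular element of ℤ, so order zero is treated
  -- apart.
  rcases isEmpty_or_nonempty n with hn | hn
  · exact ⟨fun i => (hn.false i).elim, by ext i; exact (hn.false i).elim,
      by ext i; exact (hn.false i).elim⟩
  · refine Matrix.IsHadamard.of_mul_conjTranspose
      (fun i j => Unitary.mem_iff_eq_one_or_eq_neg_one.mpr (hH i j)) ?_ ?_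
    · rw [Matrix.conjTranspose_eq_transpose_of_trivial, hmul]
    · exact IsRegular.of_ne_zero (by exact_mod_cast Fintype.card_ne_zero)

/-- There is a Hadamard matrix of order `n`. -/
def IsHadamardOrder (n : ℕ) : Prop :=
  ∃ H : Matrix (Fin n) (Fin n) ℤ, H.IsHadamard

theorem Matrix.IsHadamard.isHadamardOrder {n : Type*} [Fintype n] [DecidableEq n]
    {H : Matrix n n ℤ} (hH : H.IsHadamard) : IsHadamardOrder (Fintype.card n) :=
  ⟨_, hH.reindex (Fintype.equivFin n) (Fintype.equivFin n)⟩

theorem IsHadamardOrder.mul {a b : ℕ} (ha : IsHadamardOrder a) (hb : IsHadamardOrder b) :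
    IsHadamardOrder (a * b) := by
  obtain ⟨A, hA⟩ := ha
  obtain ⟨B, hB⟩ := hb
  simpa using (hA.kronecker hB).isHadamardOrder

theorem isHadamardOrder_one : IsHadamardOrder 1 :=
  ⟨1, Matrix.isHadamard_int (fun i j => Or.inl (by rw [Subsingleton.elim i j, Matrix.one_apply_eq]))
    (by simp)⟩

theorem isHadamardOrder_two : IsHadamardOrder 2 := by
  refine ⟨!![1, 1; 1, -1], Matrix.isHadamard_int ?_ ?_⟩
  · intro i j
    fin_cases i <;> fin_cases j <;> simp
  · ext i j
    fin_cases i <;> fin_cases j <;> simp [Matrix.mul_apply]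

theorem isHadamardOrder_two_pow (p : ℕ) : IsHadamardOrder (2 ^ p) := by
  induction p with
  | zero => exact isHadamardOrder_one
  | succ p ih => exact ih.mul isHadamardOrder_two

/-- Common source of the Paley and Williamson matrices. The zero diagonal of C gives the two
summands complementary supports, and the Gram matrix expands to 1 ⊗ (c AAᵀ + BBᵀ) + C ⊗ (ABᵀ + ε
BAᵀ). -/
theorem Matrix.isHadamard_kronecker_add {m n : Type*} [Fintype m] [DecidableEq m] [Fintype n]
    [DecidableEq n] {C : Matrix m m ℤ} {A B : Matrix n n ℤ} {ε c : ℤ}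
    (hC0 : ∀ i, C i i = 0) (hC1 : ∀ i j, i ≠ j → C i j = 1 ∨ C i j = -1)
    (hCt : C.transpose = ε • C) (hCC : C * C.transpose = c • (1 : Matrix m m ℤ))
    (hA : ∀ i j, C ≠ 0 → A i j = 1 ∨ A i j = -1) (hB : ∀ i j, B i j = 1 ∨ B i j = -1)
    (hAB : c • (A * A.transpose) + B * B.transpose =
      ((Fintype.card m * Fintype.card n : ℕ) : ℤ) • (1 : Matrix n n ℤ))
    (hx : A * B.transpose + ε • (B * A.transpose) = 0) :
    (C ⊗ₖ A + (1 : Matrix m m ℤ) ⊗ₖ B).IsHadamard := by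
  refine Matrix.isHadamard_int ?_ ?_
  · rintro ⟨i, i'⟩ ⟨j, j'⟩
    rcases eq_or_ne i j with rfl | hij
    · simpa [Matrix.kroneckerMap_apply, hC0] using hB i' j'
    · have hne : C ≠ 0 := by
        rintro rfl
        simpa using hC1 i j hij
      rcases hC1 i j hij with h | h <;> rcases hA i' j' hne with h' | h' <;>
        simp [Matrix.kroneckerMap_apply, hij, h, h']
  · rw [Matrix.transpose_add, ← Matrix.kroneckerMap_transpose, ← Matrix.kroneckerMap_transpose,
      Matrix.add_mul, Matrix.mul_add, Matrix.mul_add, ← Matrix.mul_kronecker_mul,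
      ← Matrix.mul_kronecker_mul, ← Matrix.mul_kronecker_mul, ← Matrix.mul_kronecker_mul, hCC, hCt]
    have h1 : C * (1 : Matrix m m ℤ).transpose = C := by simp
    have h2 : (1 : Matrix m m ℤ) * (ε • C) = ε • C := by simp
    have h3 : (1 : Matrix m m ℤ) * (1 : Matrix m m ℤ).transpose = 1 := by simp
    rw [h1, h2, h3, Matrix.smul_kronecker, Matrix.smul_kronecker, ← Matrix.kronecker_smul,
      ← Matrix.kronecker_smul]
    have h4 : (1 : Matrix m m ℤ) ⊗ₖ (c • (A * A.transpose)) + C ⊗ₖ (A * B.transpose) +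
        (C ⊗ₖ (ε • (B * A.transpose)) + (1 : Matrix m m ℤ) ⊗ₖ (B * B.transpose)) =
        (1 : Matrix m m ℤ) ⊗ₖ (c • (A * A.transpose) + B * B.transpose) +
          C ⊗ₖ (A * B.transpose + ε • (B * A.transpose)) := by
      rw [Matrix.kronecker_add, Matrix.kronecker_add]
      abel
    rw [h4, hAB, hx, Matrix.kronecker_zero, add_zero, Matrix.kronecker_smul,
      Matrix.one_kronecker_one, Fintype.card_prod]

/-! ### Quadratic characters and the Jacobsthal and Paley matrices of a finite field. -/

section Paley

variable {F : Type*} [Field F] [Fintype F] [DecidableEq F]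

/-- For x ≠ y, substituting z = x - (x - y)u turns the sum into χ(-1) times the Jacobi sum J(χ, χ) =
-χ(-1). -/
theorem quadraticChar_correlation (hF : ringChar F ≠ 2) (x y : F) :
    ∑ z, quadraticChar F (x - z) * quadraticChar F (y - z) =
      if x = y then (Fintype.card F : ℤ) - 1 else -1 := by
  set χ := quadraticChar F
  split_ifs with hxy
  · subst hxy
    have h1 : ∀ z, χ (x - z) * χ (x - z) = if z = x then 0 else 1 := by
      intro z
      split_ifs with h
      · rw [h, sub_self, MulChar.map_zero, mul_zero]
      · rw [← sq]
        exact quadraticChar_sq_one (sub_ne_zero.mpr (Ne.symm h))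
    have h2 : ∀ z : F, (if z = x then (0 : ℤ) else 1) = 1 - if z = x then 1 else 0 := by
      intro z
      split_ifs <;> simp
    simp [h1, h2, Finset.sum_sub_distrib]
  · have hd : x - y ≠ 0 := sub_ne_zero.mpr hxy
    have hq : χ * χ = 1 := (quadraticChar_isQuadratic F).sq_eq_one ▸ (sq χ).symm
    have hinv : χ⁻¹ = χ := inv_eq_of_mul_eq_one_left hq
    have hj : jacobiSum χ χ = -χ (-1) := by
      have := jacobiSum_nontrivial_inv (quadraticChar_ne_one hF)
      rwa [hinv] at this
    have h1 : ∑ z, χ (x - z) * χ (y - z) =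
        ∑ u, χ (x - (x - (x - y) * u)) * χ (y - (x - (x - y) * u)) :=
      (Equiv.sum_comp ((Equiv.mulLeft₀ (x - y) hd).trans (Equiv.subLeft x))
        (fun z => χ (x - z) * χ (y - z))).symm
    have h2 : ∀ u, χ (x - (x - (x - y) * u)) * χ (y - (x - (x - y) * u)) =
        χ (-1) * (χ u * χ (1 - u)) := by
      intro u
      have e1 : x - (x - (x - y) * u) = (x - y) * u := by ring
      have e2 : y - (x - (x - y) * u) = (x - y) * (-1 * (1 - u)) := by ring
      have e3 : χ (x - y) * χ (x - y) = 1 := by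
        rw [← sq]; exact quadraticChar_sq_one hd
      rw [e1, e2, map_mul, map_mul, map_mul]
      linear_combination (χ u * χ (-1) * χ (1 - u)) * e3
    rw [h1, Finset.sum_congr rfl (fun u _ => h2 u), ← Finset.mul_sum]
    have h3 : ∑ u, χ u * χ (1 - u) = -χ (-1) := hj
    have h4 : χ (-1) * χ (-1) = 1 := by
      rw [← sq]; exact quadraticChar_sq_one (neg_ne_zero.mpr one_ne_zero)
    rw [h3]
    linear_combination -h4

variable (F) in
/-- The Jacobsthal matrix of a finite field. -/
def jacobsthalMatrix : Matrix F F ℤ := Matrix.of fun x y => quadraticChar F (x - y)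

variable (F) in
/-- The Paley conference matrix, obtained by bordering the Jacobsthal matrix. -/
def paleyConference : Matrix (Option F) (Option F) ℤ
  | none, none => 0
  | none, some _ => 1
  | some _, none => quadraticChar F (-1)
  | some x, some y => quadraticChar F (x - y)

theorem quadraticChar_sub_comm (x y : F) :
    quadraticChar F (y - x) = quadraticChar F (-1) * quadraticChar F (x - y) := by
  rw [← map_mul]
  congr 1
  ring

theorem quadraticChar_neg_one_mul_self : quadraticChar F (-1) * quadraticChar F (-1) = 1 := by
  rw [← sq]
  exact quadraticChar_sq_one (neg_ne_zero.mpr one_ne_zero)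

theorem sum_quadraticChar_sub (hF : ringChar F ≠ 2) (x : F) :
    ∑ z, quadraticChar F (x - z) = 0 := by
  rw [← quadraticChar_sum_zero hF]
  exact Equiv.sum_comp (Equiv.subLeft x) (quadraticChar F)

theorem sum_quadraticChar_sub_right (hF : ringChar F ≠ 2) (x : F) :
    ∑ z, quadraticChar F (z - x) = 0 := by
  rw [← quadraticChar_sum_zero hF]
  exact Equiv.sum_comp (Equiv.subRight x) (quadraticChar F)

theorem paleyConference_diag (i : Option F) : paleyConference F i i = 0 := by
  cases i <;> simp [paleyConference]

theorem paleyConference_off_diag (i j : Option F) (hij : i ≠ j) :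
    paleyConference F i j = 1 ∨ paleyConference F i j = -1 := by
  cases i <;> cases j
  · exact (hij rfl).elim
  · exact Or.inl rfl
  · exact quadraticChar_dichotomy (neg_ne_zero.mpr one_ne_zero)
  · exact quadraticChar_dichotomy (sub_ne_zero.mpr fun h => hij (by rw [h]))

/-- The entry χ(-1) in the border column is chosen for this: it is the factor by which χ(x - y)
changes when x and y are exchanged. -/
theorem paleyConference_transpose :
    (paleyConference F).transpose = quadraticChar F (-1) • paleyConference F := by
  ext i j
  cases i <;> cases j <;>
    simp only [Matrix.transpose_apply, Matrix.smul_apply, paleyConference, smul_eq_mul, mul_zero,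
      mul_one]
  · exact quadraticChar_neg_one_mul_self.symm
  · exact quadraticChar_sub_comm _ _

/-- Distinct Jacobsthal rows have inner product -1, which the border corrects by χ(-1)² = 1; against
the first row only a vanishing character sum appears. -/
theorem paleyConference_mul_transpose (hF : ringChar F ≠ 2) :
    paleyConference F * (paleyConference F).transpose =
      (Fintype.card F : ℤ) • (1 : Matrix (Option F) (Option F) ℤ) := by
  have hs := sum_quadraticChar_sub hF
  ext i j
  rw [Matrix.mul_apply, Fintype.sum_option]
  cases i <;> cases j <;>
    simp only [Matrix.transpose_apply, Matrix.smul_apply, paleyConference, smul_eq_mul, mul_zero,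
      mul_one, one_mul, zero_mul, zero_add, hs, quadraticChar_correlation hF]
  · simp
  · simp
  · simp
  · rw [quadraticChar_neg_one_mul_self]
    rename_i x y
    rcases eq_or_ne x y with rfl | h
    · simp
    · simp [h]

theorem jacobsthalMatrix_mul_transpose (hF : ringChar F ≠ 2) :
    jacobsthalMatrix F * (jacobsthalMatrix F).transpose =
      (Fintype.card F : ℤ) • (1 : Matrix F F ℤ) - Matrix.of fun _ _ => 1 := by
  ext x y
  simp only [Matrix.mul_apply, jacobsthalMatrix, Matrix.transpose_apply, Matrix.of_apply,
    quadraticChar_correlation hF, Matrix.sub_apply, Matrix.smul_apply, Matrix.one_apply]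
  split_ifs <;> simp

end Paley

/-! ### Hadamard and conference matrices from finite fields. -/

theorem exists_field_card_eq {q : ℕ} (hq : IsPrimePow q) :
    ∃ (F : Type) (_ : Field F) (_ : Fintype F), Fintype.card F = q := by
  have h := (Fintype.nonempty_field_iff (α := Fin q)).mpr (by simpa using hq)
  exact ⟨Fin q, h.some, inferInstance, Fintype.card_fin q⟩

theorem ringChar_ne_two_of_odd_card {F : Type*} [Field F] [Fintype F]
    (h : Odd (Fintype.card F)) : ringChar F ≠ 2 := by
  intro h2
  have := FiniteField.even_card_iff_char_two.mp h2
  rw [Nat.odd_iff] at h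
  omega

theorem quadraticChar_neg_one_of_card_mod_four_eq_three {F : Type*} [Field F] [Fintype F]
    [DecidableEq F] (h : Fintype.card F % 4 = 3) : quadraticChar F (-1) = -1 := by
  rw [quadraticChar_neg_one_iff_not_isSquare, FiniteField.isSquare_neg_one_iff]
  simpa using h

theorem quadraticChar_neg_one_of_card_mod_four_eq_one {F : Type*} [Field F] [Fintype F]
    [DecidableEq F] (h : Fintype.card F % 4 = 1) : quadraticChar F (-1) = 1 := by
  rw [quadraticChar_one_iff_isSquare (neg_ne_zero.mpr one_ne_zero),
    FiniteField.isSquare_neg_one_iff]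
  omega

/-- Paley's first construction. -/
theorem isHadamardOrder_paley_one {q : ℕ} (hq : IsPrimePow q) (h4 : q % 4 = 3) :
    IsHadamardOrder (q + 1) := by
  classical
  obtain ⟨F, _, _, rfl⟩ := exists_field_card_eq hq
  have hF : ringChar F ≠ 2 := ringChar_ne_two_of_odd_card (Nat.odd_iff.mpr (by omega))
  -- With 1 × 1 blocks this is C + 1; the cross terms cancel because C is skew when q ≡ 3 mod 4.
  have := (Matrix.isHadamard_kronecker_add (A := (1 : Matrix Unit Unit ℤ)) (B := 1)
    paleyConference_diag paleyConference_off_diag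
    (paleyConference_transpose (F := F)) (paleyConference_mul_transpose hF)
    (by simp) (by simp) (by simp)
    (by rw [quadraticChar_neg_one_of_card_mod_four_eq_three h4]; simp)).isHadamardOrder
  simpa using this

/-- Paley's second construction. -/
theorem isHadamardOrder_paley_two {q : ℕ} (hq : IsPrimePow q) (h4 : q % 4 = 1) :
    IsHadamardOrder (2 * (q + 1)) := by
  classical
  obtain ⟨F, _, _, rfl⟩ := exists_field_card_eq hq
  have hF : ringChar F ≠ 2 := ringChar_ne_two_of_odd_card (Nat.odd_iff.mpr (by omega))
  have hA : (!![1, 1; 1, -1] : Matrix (Fin 2) (Fin 2) ℤ).transpose = !![1, 1; 1, -1] := by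
    ext i j
    fin_cases i <;> fin_cases j <;> rfl
  have hB : (!![1, -1; -1, -1] : Matrix (Fin 2) (Fin 2) ℤ).transpose = !![1, -1; -1, -1] := by
    ext i j
    fin_cases i <;> fin_cases j <;> rfl
  -- Here C is symmetric, so the cross terms require A and B to anticommute; both are symmetric with
  -- square 2.
  have := (Matrix.isHadamard_kronecker_add (A := !![1, 1; 1, -1]) (B := !![1, -1; -1, -1])
    paleyConference_diag paleyConference_off_diag
    (paleyConference_transpose (F := F)) (paleyConference_mul_transpose hF)
    (by intro i j _; fin_cases i <;> fin_cases j <;> simp)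
    (by intro i j; fin_cases i <;> fin_cases j <;> simp)
    (by
      rw [hA, hB, Matrix.mul_fin_two, Matrix.mul_fin_two, Matrix.one_fin_two]
      ext i j
      fin_cases i <;> fin_cases j <;> simp
      all_goals ring)
    (by
      rw [quadraticChar_neg_one_of_card_mod_four_eq_one h4, hA, hB, Matrix.mul_fin_two,
        Matrix.mul_fin_two]
      ext i j
      fin_cases i <;> fin_cases j <;> simp)).isHadamardOrder
  simpa [mul_comm] using this

/-- Williamson's construction of a Hadamard matrix of order `q(q + 1)`. -/
theorem isHadamardOrder_mul_succ {q : ℕ} (hq : IsPrimePow q) (h4 : q % 4 = 3) :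
    IsHadamardOrder (q * (q + 1)) := by
  classical
  obtain ⟨F, _, _, rfl⟩ := exists_field_card_eq hq
  have hF : ringChar F ≠ 2 := ringChar_ne_two_of_odd_card (Nat.odd_iff.mpr (by omega))
  have hε := quadraticChar_neg_one_of_card_mod_four_eq_three h4
  have hQt : (jacobsthalMatrix F).transpose = -jacobsthalMatrix F := by
    ext x y
    simp only [jacobsthalMatrix, Matrix.transpose_apply, Matrix.of_apply, Matrix.neg_apply]
    rw [quadraticChar_sub_comm, hε, neg_one_mul]
  have hQQ := jacobsthalMatrix_mul_transpose hF
  set J : Matrix F F ℤ := Matrix.of fun _ _ => 1 with hJ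
  have hJJ : J * J = (Fintype.card F : ℤ) • J := by
    ext x y
    simp [hJ, Matrix.mul_apply]
  have hJt : J.transpose = J := by
    ext x y
    simp [hJ]
  have hQJ : jacobsthalMatrix F * J = 0 := by
    ext x y
    simp [hJ, Matrix.mul_apply, jacobsthalMatrix, sum_quadraticChar_sub hF,
      -quadraticChar_apply]
  have hJQ : J * jacobsthalMatrix F = 0 := by
    ext x y
    simp [hJ, Matrix.mul_apply, jacobsthalMatrix, sum_quadraticChar_sub_right hF,
      -quadraticChar_apply]
  -- Let Q be the Jacobsthal matrix, which is skew with QJ = JQ = 0. Then ABᵀ = BAᵀ = J cancel under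
  -- ε = -1, and q(1 + QQᵀ) + JJᵀ = q(q + 1 - J) + qJ = q(q + 1).
  have := (Matrix.isHadamard_kronecker_add (A := 1 + jacobsthalMatrix F) (B := J)
    paleyConference_diag paleyConference_off_diag
    (paleyConference_transpose (F := F)) (paleyConference_mul_transpose hF)
    (by
      intro x y _
      rcases eq_or_ne x y with rfl | h
      · simp [jacobsthalMatrix]
      · simpa [jacobsthalMatrix, h] using quadraticChar_dichotomy (sub_ne_zero.mpr h))
    (by simp [hJ])
    (by
      rw [hQt] at hQQ
      rw [Matrix.transpose_add, hQt, Matrix.transpose_one, Matrix.add_mul, Matrix.mul_add,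
        Matrix.mul_add, hQQ, hJt, hJJ]
      push_cast [Fintype.card_option]
      rw [one_mul, one_mul, mul_one]
      module)
    (by
      rw [hε, hJt, Matrix.transpose_add, hQt, Matrix.transpose_one, Matrix.add_mul,
        Matrix.mul_add, hQJ, Matrix.mul_neg, hJQ]
      simp)).isHadamardOrder
  simpa [mul_comm] using this

theorem exists_conference_of_odd_primePow {q : ℕ} (hq : IsPrimePow q) (hodd : Odd q) :
    ∃ C : Matrix (Fin (q + 1)) (Fin (q + 1)) ℤ,
      (∀ i j, C i j = 0 ∨ C i j = 1 ∨ C i j = -1) ∧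
      C * C.transpose = (q : ℤ) • (1 : Matrix (Fin (q + 1)) (Fin (q + 1)) ℤ) := by
  classical
  obtain ⟨F, _, _, rfl⟩ := exists_field_card_eq hq
  have hF : ringChar F ≠ 2 := ringChar_ne_two_of_odd_card hodd
  let e : Fin (Fintype.card F + 1) ≃ Option F := (Fintype.equivFinOfCardEq (by simp)).symm
  refine ⟨(paleyConference F).submatrix e e, fun i j => ?_, ?_⟩
  · rcases eq_or_ne (e i) (e j) with h | h
    · left
      simp [h, paleyConference_diag]
    · exact Or.inr (paleyConference_off_diag _ _ h)
  · rw [Matrix.transpose_submatrix, Matrix.submatrix_mul_equiv, paleyConference_mul_transpose hF]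
    rw [Matrix.submatrix_smul, Pi.smul_apply, Pi.smul_apply, Matrix.submatrix_one_equiv]

/-! ### The Goethals–Seidel array and Golay pairs -/

section GoethalsSeidel

variable {γ : Type*} [AddCommGroup γ] [DecidableEq γ]

variable (γ) in
/-- The permutation matrix of negation. -/
def negationMatrix : Matrix γ γ ℤ := Matrix.of fun i j => if i + j = 0 then 1 else 0

theorem negationMatrix_transpose : (negationMatrix γ).transpose = negationMatrix γ := by
  ext i j
  simp [negationMatrix, add_comm]

variable [Fintype γ]

theorem negationMatrix_mul_apply (M : Matrix γ γ ℤ) (i j : γ) :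
    (negationMatrix γ * M) i j = M (-i) j := by
  simp [Matrix.mul_apply, negationMatrix, add_eq_zero_iff_neg_eq]

theorem mul_negationMatrix_apply (M : Matrix γ γ ℤ) (i j : γ) :
    (M * negationMatrix γ) i j = M i (-j) := by
  simp [Matrix.mul_apply, negationMatrix, add_eq_zero_iff_eq_neg]

theorem negationMatrix_mul_self : negationMatrix γ * negationMatrix γ = 1 := by
  ext i j
  rw [negationMatrix_mul_apply]
  simp [negationMatrix, Matrix.one_apply, neg_add_eq_zero]

/-- Conjugation by the negation matrix transposes a circulant; this makes the cross terms of the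
Goethals–Seidel array cancel. -/
theorem negationMatrix_mul_circulant (a : γ → ℤ) :
    negationMatrix γ * Matrix.circulant a =
      Matrix.circulant (fun i => a (-i)) * negationMatrix γ := by
  ext i j
  rw [negationMatrix_mul_apply, mul_negationMatrix_apply]
  simp only [Matrix.circulant_apply]
  congr 1
  abel

/-- The four circulants fill a Goethals–Seidel array. Circulants commute, R² = 1 and moving R past a
circulant transposes it, so the off-diagonal blocks of the Gram matrix cancel and each diagonal
block is the sum in `h`. -/
theorem isHadamardOrder_of_circulants (a b c d : γ → ℤ)
    (ha : ∀ i, a i = 1 ∨ a i = -1) (hb : ∀ i, b i = 1 ∨ b i = -1)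
    (hc : ∀ i, c i = 1 ∨ c i = -1) (hd : ∀ i, d i = 1 ∨ d i = -1)
    (h : Matrix.circulant a * (Matrix.circulant a).transpose +
        Matrix.circulant b * (Matrix.circulant b).transpose +
        Matrix.circulant c * (Matrix.circulant c).transpose +
        Matrix.circulant d * (Matrix.circulant d).transpose =
      ((4 * Fintype.card γ : ℕ) : ℤ) • (1 : Matrix γ γ ℤ)) :
    IsHadamardOrder (4 * Fintype.card γ) := by
  set R := negationMatrix γ with hR
  let P : (γ → ℤ) → Matrix γ γ ℤ := Matrix.circulant
  let ν : (γ → ℤ) → (γ → ℤ) := fun f i => f (-i)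
  have hν : ∀ f, ν (ν f) = f := fun f => by ext i; simp [ν]
  have hPt : ∀ f, (P f).transpose = P (ν f) := fun f => Matrix.transpose_circulant f
  have hcomm : ∀ f g, P f * P g = P g * P f := fun f g => Matrix.circulant_mul_comm f g
  have hRt : R.transpose = R := negationMatrix_transpose
  have hRR : R * R = 1 := negationMatrix_mul_self
  have hRP : ∀ f, R * P f = P (ν f) * R := negationMatrix_mul_circulant
  have hRP' : ∀ f X, R * (P f * X) = P (ν f) * (R * X) := fun f X => by
    rw [← mul_assoc, hRP, mul_assoc]
  have hcomm' : ∀ f g X, P f * (P g * X) = P g * (P f * X) := fun f g X => by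
    rw [← mul_assoc, hcomm, mul_assoc]
  have h' : P a * P (ν a) + P b * P (ν b) + P c * P (ν c) + P d * P (ν d) =
      ((4 * Fintype.card γ : ℕ) : ℤ) • (1 : Matrix γ γ ℤ) := by
    rw [← hPt, ← hPt, ← hPt, ← hPt]
    exact h
  have hent : ∀ f : γ → ℤ, (∀ i, f i = 1 ∨ f i = -1) → ∀ i j, P f i j = 1 ∨ P f i j = -1 :=
    fun f hf i j => hf _
  have hentν : ∀ f : γ → ℤ, (∀ i, f i = 1 ∨ f i = -1) → ∀ i j, P (ν f) i j = 1 ∨ P (ν f) i j = -1 :=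
    fun f hf i j => hf _
  have hentR : ∀ X : Matrix γ γ ℤ, (∀ i j, X i j = 1 ∨ X i j = -1) →
      ∀ i j, (X * R) i j = 1 ∨ (X * R) i j = -1 := fun X hX i j => by
    rw [hR, mul_negationMatrix_apply]
    exact hX _ _
  have hentn : ∀ X : Matrix γ γ ℤ, (∀ i j, X i j = 1 ∨ X i j = -1) →
      ∀ i j, (-X) i j = 1 ∨ (-X) i j = -1 := fun X hX i j => by
    rcases hX i j with h | h <;> simp [h]
  have hblock : ∀ X Y Z W : Matrix γ γ ℤ, (∀ i j, X i j = 1 ∨ X i j = -1) →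
      (∀ i j, Y i j = 1 ∨ Y i j = -1) → (∀ i j, Z i j = 1 ∨ Z i j = -1) →
      (∀ i j, W i j = 1 ∨ W i j = -1) → ∀ i j,
      Matrix.fromBlocks X Y Z W i j = 1 ∨ Matrix.fromBlocks X Y Z W i j = -1 := by
    rintro X Y Z W hX hY hZ hW (i | i) (j | j)
    exacts [hX i j, hY i j, hZ i j, hW i j]
  have hblock2 : ∀ X Y Z W : Matrix (γ ⊕ γ) (γ ⊕ γ) ℤ, (∀ i j, X i j = 1 ∨ X i j = -1) →
      (∀ i j, Y i j = 1 ∨ Y i j = -1) → (∀ i j, Z i j = 1 ∨ Z i j = -1) →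
      (∀ i j, W i j = 1 ∨ W i j = -1) → ∀ i j,
      Matrix.fromBlocks X Y Z W i j = 1 ∨ Matrix.fromBlocks X Y Z W i j = -1 := by
    rintro X Y Z W hX hY hZ hW (i | i) (j | j)
    exacts [hX i j, hY i j, hZ i j, hW i j]
  have hH : (Matrix.fromBlocks
      (Matrix.fromBlocks (P a) (P b * R) (-(P b * R)) (P a))
      (Matrix.fromBlocks (P c * R) (P d * R) (P (ν d) * R) (-(P (ν c) * R)))
      (Matrix.fromBlocks (-(P c * R)) (-(P (ν d) * R)) (-(P d * R)) (P (ν c) * R))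
      (Matrix.fromBlocks (P a) (P (ν b) * R) (-(P (ν b) * R)) (P a))).IsHadamard := by
    have pa := hent a ha
    have pb := hentR _ (hent b hb)
    have pc := hentR _ (hent c hc)
    have pd := hentR _ (hent d hd)
    have pb' := hentR _ (hentν b hb)
    have pc' := hentR _ (hentν c hc)
    have pd' := hentR _ (hentν d hd)
    refine Matrix.isHadamard_int (hblock2 _ _ _ _ (hblock _ _ _ _ pa pb (hentn _ pb) pa)
      (hblock _ _ _ _ pc pd pd' (hentn _ pc'))
      (hblock _ _ _ _ (hentn _ pc) (hentn _ pd') (hentn _ pd) pc')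
      (hblock _ _ _ _ pa pb' (hentn _ pb') pa)) ?_
    have hcard : Fintype.card ((γ ⊕ γ) ⊕ (γ ⊕ γ)) = 4 * Fintype.card γ := by
      simp only [Fintype.card_sum]
      ring
    have hone : ((4 * Fintype.card γ : ℕ) : ℤ) • (1 : Matrix ((γ ⊕ γ) ⊕ (γ ⊕ γ)) ((γ ⊕ γ) ⊕ (γ ⊕ γ)) ℤ) =
        Matrix.fromBlocks
          (Matrix.fromBlocks (((4 * Fintype.card γ : ℕ) : ℤ) • 1) 0 0
            (((4 * Fintype.card γ : ℕ) : ℤ) • 1)) 0 0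
          (Matrix.fromBlocks (((4 * Fintype.card γ : ℕ) : ℤ) • 1) 0 0
            (((4 * Fintype.card γ : ℕ) : ℤ) • 1)) := by
      rw [← Matrix.fromBlocks_one, Matrix.fromBlocks_smul, ← Matrix.fromBlocks_one,
        Matrix.fromBlocks_smul, smul_zero, smul_zero]
    have hzero : (0 : Matrix (γ ⊕ γ) (γ ⊕ γ) ℤ) = Matrix.fromBlocks 0 0 0 0 :=
      Matrix.fromBlocks_zero.symm
    rw [hcard, hone, hzero, ← h']
    simp only [Matrix.fromBlocks_transpose, Matrix.fromBlocks_multiply, Matrix.transpose_neg,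
      Matrix.transpose_mul, hPt, hRt, Matrix.fromBlocks_add, hν, mul_assoc, hRR, hRP, hRP',
      neg_mul, mul_neg, neg_neg, mul_one]
    clear_value P ν
    simp only [Matrix.fromBlocks_inj]
    refine ⟨⟨?_, ?_, ?_, ?_⟩, ⟨?_, ?_, ?_, ?_⟩, ⟨?_, ?_, ?_, ?_⟩, ?_, ?_, ?_, ?_⟩
    -- Every block is now a signed sum of products of two circulants, possibly followed by R; these
    -- rewrites bring equal products to the same order.
    all_goals try simp only [hcomm' _ a, hcomm d c, hcomm (ν d) (ν c), hcomm (ν d) d,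
      hcomm (ν c) c, hcomm (ν b) b, hcomm d b, hcomm c b, hcomm (ν c) b, hcomm (ν d) b,
      hcomm (ν d) (ν b), hcomm (ν b) c, hcomm (ν c) (ν b), hcomm (ν b) d, hcomm (ν d) c,
      hcomm (ν c) d]
    all_goals abel
  have := hH.isHadamardOrder
  rw [show Fintype.card ((γ ⊕ γ) ⊕ (γ ⊕ γ)) = 4 * Fintype.card γ by
    simp only [Fintype.card_sum]; ring] at this
  exact this

end GoethalsSeidel

/-- The doubling (x, y) ↦ (x + zᵍy, x - zᵍy) cancels the cross terms and doubles the sum of norms,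
as zᵍwᵍ = 1. Here w stands for the inverse of z; below they are a cyclic shift and its transpose. -/
theorem exists_golay_pair {S : Type*} [Ring S] {z w : S} (hzw : Commute z w) (h1 : z * w = 1)
    (k : ℕ) : ∃ ε δ : ℕ → ℤ, (∀ i, ε i = 1 ∨ ε i = -1) ∧ (∀ i, δ i = 1 ∨ δ i = -1) ∧
      (∑ i ∈ Finset.range (2 ^ k), ε i • z ^ i) * (∑ i ∈ Finset.range (2 ^ k), ε i • w ^ i) +
      (∑ i ∈ Finset.range (2 ^ k), δ i • z ^ i) * (∑ i ∈ Finset.range (2 ^ k), δ i • w ^ i) =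
      ((2 ^ (k + 1) : ℕ) : S) := by
  induction k with
  | zero =>
    refine ⟨fun _ => 1, fun _ => 1, fun _ => Or.inl rfl, fun _ => Or.inl rfl, ?_⟩
    simp [one_add_one_eq_two]
  | succ k ih =>
    obtain ⟨ε, δ, hε, hδ, h⟩ := ih
    set g := 2 ^ k with hg
    have key : ∀ (η : ℤ) (v : S), ∑ i ∈ Finset.range (2 ^ (k + 1)),
        (if i < g then ε i else η * δ (i - g)) • v ^ i =
        ∑ i ∈ Finset.range g, ε i • v ^ i +
          η • (v ^ g * ∑ i ∈ Finset.range g, δ i • v ^ i) := by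
      intro η v
      rw [show 2 ^ (k + 1) = g + g by rw [hg]; ring, Finset.sum_range_add, Finset.mul_sum,
        Finset.smul_sum]
      congr 1
      · exact Finset.sum_congr rfl fun i hi => by rw [if_pos (Finset.mem_range.mp hi)]
      · refine Finset.sum_congr rfl fun i _ => ?_
        rw [if_neg (by omega), Nat.add_sub_cancel_left, pow_add, mul_smul, mul_smul_comm]
    -- The factors 1 and -1 are the two values of η in `key`.
    refine ⟨fun i => if i < g then ε i else 1 * δ (i - g),
      fun i => if i < g then ε i else (-1) * δ (i - g), fun i => ?_, fun i => ?_, ?_⟩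
    · dsimp only
      split_ifs
      · exact hε i
      · simpa using hδ _
    · dsimp only
      split_ifs
      · exact hε i
      · rcases hδ (i - g) with h | h <;> simp [h]
    · simp only [key]
      set x := ∑ i ∈ Finset.range g, ε i • z ^ i
      set x' := ∑ i ∈ Finset.range g, ε i • w ^ i
      set y := ∑ i ∈ Finset.range g, δ i • z ^ i with hy
      set y' := ∑ i ∈ Finset.range g, δ i • w ^ i
      have hyw : Commute y (w ^ g) :=
        Commute.sum_left _ _ _ fun i _ => (hzw.pow_pow i g).smul_left _
      have hcross : z ^ g * y * (w ^ g * y') = y * y' := by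
        rw [mul_assoc, ← mul_assoc y, hyw.eq, mul_assoc, ← mul_assoc, ← hzw.mul_pow, h1, one_pow,
          one_mul]
      have expand : (x + (1 : ℤ) • (z ^ g * y)) * (x' + (1 : ℤ) • (w ^ g * y')) +
          (x + (-1 : ℤ) • (z ^ g * y)) * (x' + (-1 : ℤ) • (w ^ g * y')) =
          2 * (x * x' + z ^ g * y * (w ^ g * y')) := by
        rw [one_smul, one_smul, neg_one_smul, neg_one_smul]
        noncomm_ring
      rw [expand, hcross, h]
      push_cast
      rw [pow_succ 2 (k + 1)]
      exact (Nat.cast_commute 2 _).eq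

/-- Prefixing a 1 to ±ε and ±δ gives four sequences of length 2ᵏ + 1. In the sum of the norms of 1 ±
zx and 1 ± zy the linear terms cancel in pairs, leaving 4 + 2 · 2ᵏ⁺¹ by the Golay identity. -/
theorem isHadamardOrder_four_mul_two_pow_add_one (k : ℕ) :
    IsHadamardOrder (4 * (2 ^ k + 1)) := by
  set g := 2 ^ k with hg
  let z : Matrix (ZMod (g + 1)) (ZMod (g + 1)) ℤ := Matrix.circulant (Pi.single 1 1)
  have hz_pow : ∀ i : ℕ, z ^ i = Matrix.circulant (Pi.single (i : ZMod (g + 1)) 1) := by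
    intro i
    induction i with
    | zero => simp
    | succ i ih =>
      rw [pow_succ, ih, Matrix.circulant_mul]
      congr 1
      ext j
      simp [Matrix.mulVec, dotProduct, Matrix.circulant_apply, Pi.single_apply, sub_eq_iff_eq_add]
  have hzt : z.transpose = Matrix.circulant (Pi.single (-1) 1) := by
    rw [Matrix.transpose_circulant]
    congr 1
    ext j
    simp [Pi.single_apply, neg_eq_iff_eq_neg]
  have hzw : z * z.transpose = 1 := by
    rw [hzt, Matrix.circulant_mul, ← Matrix.circulant_single_one ℤ (ZMod (g + 1))]
    congr 1
    ext j
    simp [Matrix.mulVec, dotProduct, Matrix.circulant_apply, Pi.single_apply, sub_eq_iff_eq_add]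
  have hcomm : Commute z z.transpose := by
    rw [hzt]
    exact Matrix.circulant_mul_comm _ _
  obtain ⟨ε, δ, hε, hδ, h⟩ := exists_golay_pair hcomm hzw k
  have hsum : ∀ ζ : ℕ → ℤ, 1 + z * ∑ i ∈ Finset.range g, ζ i • z ^ i =
      Matrix.circulant (fun x : ZMod (g + 1) => if x.val = 0 then 1 else ζ (x.val - 1)) := by
    intro ζ
    have h1 : 1 + z * ∑ i ∈ Finset.range g, ζ i • z ^ i =
        ∑ i ∈ Finset.range (g + 1), (if i = 0 then 1 else ζ (i - 1)) • z ^ i := by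
      have h2 : ∀ i, z * ζ i • z ^ i =
          (if i + 1 = 0 then 1 else ζ (i + 1 - 1)) • z ^ (i + 1) := fun i => by
        rw [if_neg (by omega), Nat.add_sub_cancel, mul_smul_comm, pow_succ']
      rw [Finset.sum_range_succ', Finset.mul_sum, if_pos rfl, pow_zero, one_smul]
      simp only [h2]
      exact add_comm _ _
    rw [h1]
    ext x y
    have h2 : ∀ i ∈ Finset.range (g + 1), ((if i = 0 then 1 else ζ (i - 1)) • z ^ i) x y =
        if i = (x - y).val then (if i = 0 then 1 else ζ (i - 1)) else 0 := by
      intro i hi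
      have h3 : x - y = (i : ZMod (g + 1)) ↔ i = (x - y).val := by
        constructor
        · intro h
          rw [h, ZMod.val_natCast_of_lt (Finset.mem_range.mp hi)]
        · intro h
          rw [h, ZMod.natCast_zmod_val]
      rw [Matrix.smul_apply, hz_pow, Matrix.circulant_apply, Pi.single_apply]
      simp only [h3]
      split_ifs <;> simp
    rw [Matrix.sum_apply, Finset.sum_congr rfl h2, Finset.sum_ite_eq']
    rw [if_pos (Finset.mem_range.mpr (ZMod.val_lt _)), Matrix.circulant_apply]
  have htr : ∀ ζ : ℕ → ℤ, (∑ i ∈ Finset.range g, ζ i • z ^ i).transpose =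
      ∑ i ∈ Finset.range g, ζ i • z.transpose ^ i := by
    intro ζ
    rw [Matrix.transpose_sum]
    exact Finset.sum_congr rfl fun i _ => by rw [Matrix.transpose_smul, Matrix.transpose_pow]
  have hpm : ∀ ζ : ℕ → ℤ, (∀ i, ζ i = 1 ∨ ζ i = -1) → ∀ x : ZMod (g + 1),
      (if x.val = 0 then 1 else ζ (x.val - 1)) = 1 ∨
      (if x.val = 0 then 1 else ζ (x.val - 1)) = -1 := by
    intro ζ hζ x
    split_ifs
    · exact Or.inl rfl
    · exact hζ _
  have hneg : ∀ ζ : ℕ → ℤ, (∀ i, ζ i = 1 ∨ ζ i = -1) → ∀ i, (-ζ) i = 1 ∨ (-ζ) i = -1 := by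
    intro ζ hζ i
    rcases hζ i with h | h <;> simp [h]
  have := isHadamardOrder_of_circulants _ _ _ _ (hpm ε hε) (hpm (-ε) (hneg ε hε)) (hpm δ hδ)
    (hpm (-δ) (hneg δ hδ)) (by
      simp only [← hsum]
      simp only [Matrix.transpose_add, Matrix.transpose_mul, Matrix.transpose_one, htr,
        Matrix.transpose_neg, Pi.neg_apply, neg_smul, Finset.sum_neg_distrib]
      set x := ∑ i ∈ Finset.range g, ε i • z ^ i
      set x' := ∑ i ∈ Finset.range g, ε i • z.transpose ^ i
      set y := ∑ i ∈ Finset.range g, δ i • z ^ i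
      set y' := ∑ i ∈ Finset.range g, δ i • z.transpose ^ i
      have e : (1 + z * x) * (1 + x' * z.transpose) + (1 + z * -x) * (1 + -x' * z.transpose) +
          (1 + z * y) * (1 + y' * z.transpose) + (1 + z * -y) * (1 + -y' * z.transpose) =
          1 + 1 + 1 + 1 + 2 * (z * (x * x' + y * y') * z.transpose) := by
        noncomm_ring
      rw [e, h, (Nat.cast_commute _ z).symm.eq, mul_assoc, hzw, mul_one, ZMod.card,
        Nat.cast_smul_eq_nsmul, nsmul_one]
      have hcast : 1 + 1 + 1 + 1 + 2 * 2 ^ (k + 1) = 4 * (g + 1) := by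
        rw [hg]
        ring
      exact_mod_cast congrArg (Nat.cast (R := Matrix (ZMod (g + 1)) (ZMod (g + 1)) ℤ)) hcast)
  simpa [ZMod.card] using this

theorem isHadamardOrder_of_mem {n : ℕ} (hn : n ∈ paleyHadamardOrders) : IsHadamardOrder n := by
  rcases hn with ⟨p, -, rfl⟩ | ⟨p, h, q, hp, hh, hq, rfl⟩ | ⟨p, q, -, hq, hq4, rfl⟩ |
    ⟨q, hq, hq4, rfl⟩ | ⟨q, hq, hq4, rfl⟩
  · exact isHadamardOrder_two_pow p
  · obtain ⟨p, rfl⟩ := Nat.exists_eq_add_of_le' hp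
    have hpp : IsPrimePow (q ^ h) := hq.isPrimePow.pow (by omega)
    -- For q = 2 the quadratic character is of no use, and the Golay construction takes over with
    -- the factor 4 available from p ≥ 2.
    rcases hq.eq_two_or_odd' with rfl | hodd
    · rw [pow_add, mul_assoc]
      exact (isHadamardOrder_two_pow p).mul (isHadamardOrder_four_mul_two_pow_add_one h)
    · have hodd' : Odd (q ^ h) := hodd.pow
      rw [Nat.odd_iff] at hodd'
      rcases (by omega : q ^ h % 4 = 1 ∨ q ^ h % 4 = 3) with h4 | h4
      -- Paley's second construction uses up one of the factors 2.
      · have := (isHadamardOrder_two_pow (p + 1)).mul (isHadamardOrder_paley_two hpp h4)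
        rwa [← mul_assoc, ← pow_succ] at this
      · exact (isHadamardOrder_two_pow _).mul (isHadamardOrder_paley_one hpp h4)
  · rw [mul_assoc]
    exact (isHadamardOrder_two_pow p).mul (isHadamardOrder_mul_succ hq.isPrimePow hq4)
  · exact isHadamardOrder_paley_one hq hq4
  · exact isHadamardOrder_paley_two hq hq4

/-! ### Adjacency matrices of signed graphs -/

namespace SignedGraph

variable {V W : Type*}

theorem posAdj_iff (G : SignedGraph V) (u v : V) : G.PosAdj u v ↔ G.adjMatrix u v = 1 := by
  simp only [adjMatrix, Matrix.of_apply]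
  split_ifs with h1 h2 <;> simp [h1]

theorem negAdj_iff (G : SignedGraph V) (u v : V) : G.NegAdj u v ↔ G.adjMatrix u v = -1 := by
  simp only [adjMatrix, Matrix.of_apply]
  split_ifs with h1 h2
  · refine iff_of_false ?_ (by decide)
    exact fun h => h1.2 h.2
  · simp [h2]
  · simp [h2]

theorem adjMatrix_eq_zero_iff (G : SignedGraph V) (u v : V) :
    G.adjMatrix u v = 0 ↔ ¬G.graph.Adj u v := by
  simp only [adjMatrix, Matrix.of_apply]
  split_ifs with h1 h2
  · simp [h1.1]
  · simp [h2.1]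
  · simp only [true_iff]
    intro h
    by_cases hn : s(u, v) ∈ G.neg
    · exact h2 ⟨h, hn⟩
    · exact h1 ⟨h, hn⟩

theorem adj_iff_adjMatrix_ne_zero (G : SignedGraph V) (u v : V) :
    G.graph.Adj u v ↔ G.adjMatrix u v ≠ 0 := by
  rw [ne_eq, adjMatrix_eq_zero_iff, not_not]

theorem adjMatrix_entry (G : SignedGraph V) (u v : V) :
    G.adjMatrix u v = 0 ∨ G.adjMatrix u v = 1 ∨ G.adjMatrix u v = -1 := by
  simp only [adjMatrix, Matrix.of_apply]
  split_ifs <;> simp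

theorem adjMatrix_comm (G : SignedGraph V) (u v : V) : G.adjMatrix u v = G.adjMatrix v u := by
  have hP : G.PosAdj u v = G.PosAdj v u := by
    rw [PosAdj, PosAdj, Sym2.eq_swap, G.graph.adj_comm]
  have hN : G.NegAdj u v = G.NegAdj v u := by
    rw [NegAdj, NegAdj, Sym2.eq_swap, G.graph.adj_comm]
  rw [adjMatrix, Matrix.of_apply, Matrix.of_apply, hP, hN]

theorem adjMatrix_self (G : SignedGraph V) (u : V) : G.adjMatrix u u = 0 := by
  simp [adjMatrix_eq_zero_iff]

theorem adjMatrix_induce (G : SignedGraph V) (T : Set V) (u v : T) :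
    (G.induce T).adjMatrix u v = G.adjMatrix u v := by
  simp only [adjMatrix, Matrix.of_apply, PosAdj, NegAdj, induce, SimpleGraph.comap_adj,
    Set.mem_ofPred_eq, Sym2.map_mk]
  rfl

/-- The signed graph with a given symmetric `{0, 1, -1}`-matrix with zero diagonal as its
adjacency matrix. -/
def ofMatrix (M : Matrix V V ℤ) (hM : ∀ u v, M u v = M v u) (h0 : ∀ u, M u u = 0) :
    SignedGraph V where
  graph :=
    { Adj := fun u v => M u v ≠ 0
      symm := ⟨fun u v h => by rwa [hM v u]⟩
      loopless := ⟨fun u h => h (h0 u)⟩ }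
  neg := {e | ∃ u v, e = s(u, v) ∧ M u v = -1}
  neg_subset := by
    rintro e ⟨u, v, rfl, h⟩
    show M u v ≠ 0
    rw [h]
    decide

theorem adjMatrix_ofMatrix (M : Matrix V V ℤ) (hM : ∀ u v, M u v = M v u) (h0 : ∀ u, M u u = 0)
    (hent : ∀ u v, M u v = 0 ∨ M u v = 1 ∨ M u v = -1) : (ofMatrix M hM h0).adjMatrix = M := by
  ext u v
  have hadj : (ofMatrix M hM h0).graph.Adj u v ↔ M u v ≠ 0 := Iff.rfl
  have hneg : s(u, v) ∈ (ofMatrix M hM h0).neg ↔ M u v = -1 := by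
    constructor
    · rintro ⟨u', v', h, h'⟩
      rcases Sym2.eq_iff.mp h with ⟨rfl, rfl⟩ | ⟨rfl, rfl⟩
      · exact h'
      · rwa [hM]
    · exact fun h => ⟨u, v, rfl, h⟩
  simp only [adjMatrix, Matrix.of_apply, PosAdj, NegAdj, hadj, hneg]
  rcases hent u v with h | h | h <;> simp [h]

theorem adjMatrix_disjUnion (G : SignedGraph V) (H : SignedGraph W) :
    (G.disjUnion H).adjMatrix = Matrix.fromBlocks G.adjMatrix 0 0 H.adjMatrix := by
  have hl : ∀ u v : V, s(Sum.inl u, Sum.inl v) ∈ (G.disjUnion H).neg ↔ s(u, v) ∈ G.neg := by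
    intro u v
    have h1 : (s(Sum.inl u, Sum.inl v) : Sym2 (V ⊕ W)) = Sym2.map Sum.inl s(u, v) := rfl
    simp only [disjUnion, h1]
    constructor
    · rintro (⟨e, he, h⟩ | ⟨e, he, h⟩)
      · rwa [← Sym2.map.injective Sum.inl_injective h]
      · induction e with
        | _ a b => simp at h
    · exact fun h => Or.inl ⟨_, h, rfl⟩
  have hr : ∀ u v : W, s(Sum.inr u, Sum.inr v) ∈ (G.disjUnion H).neg ↔ s(u, v) ∈ H.neg := by
    intro u v
    have h1 : (s(Sum.inr u, Sum.inr v) : Sym2 (V ⊕ W)) = Sym2.map Sum.inr s(u, v) := rfl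
    simp only [disjUnion, h1]
    constructor
    · rintro (⟨e, he, h⟩ | ⟨e, he, h⟩)
      · induction e with
        | _ a b => simp at h
      · rwa [← Sym2.map.injective Sum.inr_injective h]
    · exact fun h => Or.inr ⟨_, h, rfl⟩
  ext (u | u) (v | v)
  · have ha : (G.disjUnion H).graph.Adj (Sum.inl u) (Sum.inl v) ↔ G.graph.Adj u v := by
      simp [disjUnion]
    have hP : (G.disjUnion H).PosAdj (Sum.inl u) (Sum.inl v) = G.PosAdj u v := by
      rw [PosAdj, PosAdj, hl, ha]
    have hN : (G.disjUnion H).NegAdj (Sum.inl u) (Sum.inl v) = G.NegAdj u v := by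
      rw [NegAdj, NegAdj, hl, ha]
    rw [Matrix.fromBlocks_apply₁₁, adjMatrix, adjMatrix, Matrix.of_apply, Matrix.of_apply, hP, hN]
  · simp only [Matrix.fromBlocks_apply₁₂, Matrix.zero_apply, adjMatrix_eq_zero_iff]
    simp [disjUnion]
  · simp only [Matrix.fromBlocks_apply₂₁, Matrix.zero_apply, adjMatrix_eq_zero_iff]
    simp [disjUnion]
  · have ha : (G.disjUnion H).graph.Adj (Sum.inr u) (Sum.inr v) ↔ H.graph.Adj u v := by
      simp [disjUnion]
    have hP : (G.disjUnion H).PosAdj (Sum.inr u) (Sum.inr v) = H.PosAdj u v := by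
      rw [PosAdj, PosAdj, hr, ha]
    have hN : (G.disjUnion H).NegAdj (Sum.inr u) (Sum.inr v) = H.NegAdj u v := by
      rw [NegAdj, NegAdj, hr, ha]
    rw [Matrix.fromBlocks_apply₂₂, adjMatrix, adjMatrix, Matrix.of_apply, Matrix.of_apply, hP, hN]

theorem isSwitchingIsomorphic_of_equiv {G : SignedGraph V} {H : SignedGraph W} (f : W ≃ V)
    (d : V → ℤ) (hd : ∀ v, d v = 1 ∨ d v = -1)
    (h : ∀ u v, H.adjMatrix u v = d (f u) * G.adjMatrix (f u) (f v) * d (f v)) :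
    G.IsSwitchingIsomorphic H := by
  have hK := adjMatrix_ofMatrix (G.adjMatrix.submatrix f f) (fun u v => G.adjMatrix_comm _ _)
    (fun u => G.adjMatrix_self _) (fun u v => G.adjMatrix_entry _ _)
  refine ⟨ofMatrix (G.adjMatrix.submatrix f f) (fun u v => G.adjMatrix_comm _ _)
    (fun u => G.adjMatrix_self _), ⟨d ∘ f, fun v => hd _, fun u v => ?_⟩, f.symm, ?_⟩
  · rw [hK]
    exact h u v
  · rw [hK]
    rfl

/-- The products lie in {0, 1, -1}, so signed counting is summation and `w₂` is an entry of A². -/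
theorem w₂_eq_sum [Fintype V] (G : SignedGraph V) (u v : V) :
    G.w₂ u v = ∑ w, G.adjMatrix u w * G.adjMatrix w v := by
  classical
  have h : ∀ w, G.adjMatrix u w * G.adjMatrix w v =
      (if G.adjMatrix u w * G.adjMatrix w v = 1 then 1 else 0) -
      (if G.adjMatrix u w * G.adjMatrix w v = -1 then 1 else 0) := by
    intro w
    rcases G.adjMatrix_entry u w with h1 | h1 | h1 <;>
      rcases G.adjMatrix_entry w v with h2 | h2 | h2 <;> simp [h1, h2]
  rw [Finset.sum_congr rfl fun w _ => h w, Finset.sum_sub_distrib, Finset.sum_boole,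
    Finset.sum_boole, w₂, Nat.card_eq_fintype_card, Nat.card_eq_fintype_card,
    Fintype.card_subtype, Fintype.card_subtype]

theorem degree_eq_sum [Fintype V] (G : SignedGraph V) (u : V)
    [Fintype (G.graph.neighborSet u)] :
    (G.graph.degree u : ℤ) = ∑ w, G.adjMatrix u w * G.adjMatrix w u := by
  classical
  have h : ∀ w, G.adjMatrix u w * G.adjMatrix w u = if G.graph.Adj u w then 1 else 0 := by
    intro w
    rw [G.adjMatrix_comm w u, adj_iff_adjMatrix_ne_zero]
    rcases G.adjMatrix_entry u w with h1 | h1 | h1 <;> simp [h1]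
  rw [Finset.sum_congr rfl fun w _ => h w, Finset.sum_boole]
  congr 1
  rw [← SimpleGraph.card_neighborFinset_eq_degree]
  congr 1
  ext w
  simp

/-- The hypotheses say A² = r I: the diagonal gives the degrees and the rest gives `w₂`. The bounds
on r exclude the empty and the complete graph. -/
theorem isSRG_of_sum_eq [Fintype V] (G : SignedGraph V) {n r : ℕ} (hn : Fintype.card V = n)
    (hr : 0 < r) (hrn : r + 1 < n) (hdiag : ∀ u, ∑ w, G.adjMatrix u w * G.adjMatrix w u = r)
    (hoff : ∀ u v, u ≠ v → ∑ w, G.adjMatrix u w * G.adjMatrix w v = 0) :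
    G.IsSRG n r 0 0 0 := by
  classical
  have hdeg : ∀ (v : V) [Fintype (G.graph.neighborSet v)], G.graph.degree v = r := by
    intro v _
    have := G.degree_eq_sum v
    rw [hdiag v] at this
    exact_mod_cast this
  have hV : Nonempty V := Fintype.card_pos_iff.mp (by omega)
  obtain ⟨v₀⟩ := hV
  refine ⟨hn, fun v => hdeg v, ?_, ?_, ?_, ?_, ?_⟩
  · rintro ⟨htop, -⟩
    have h1 := hdeg v₀
    have h2 : ∀ (K : SimpleGraph V) [Fintype (K.neighborSet v₀)], K = ⊤ →
        K.degree v₀ = Fintype.card V - 1 := by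
      rintro K _ rfl
      convert SimpleGraph.complete_graph_degree v₀
    have h3 := h2 _ htop
    omega
  · intro hbot
    have h1 := hdiag v₀
    have h2 : ∀ w, G.adjMatrix v₀ w = 0 := fun w => by
      simp [adjMatrix_eq_zero_iff, hbot]
    simp only [h2, zero_mul, Finset.sum_const_zero] at h1
    omega
  · exact fun u v h => by rw [w₂_eq_sum, hoff u v h.1.ne]
  · exact fun u v h => by rw [w₂_eq_sum, hoff u v h.1.ne]
  · exact fun u v h _ => by rw [w₂_eq_sum, hoff u v h]

/-! ### Totally disconnected star complements -/

theorem mem_eigenspace_iff_sum [Fintype V] (G : SignedGraph V) (μ : ℝ) (x : V → ℝ) :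
    x ∈ G.adjEnd.eigenspace μ ↔ ∀ u, ∑ v, (G.adjMatrix u v : ℝ) * x v = μ * x u := by
  rw [Module.End.mem_eigenspace_iff, funext_iff]
  exact Iff.rfl

theorem not_hasEigenvalue_of_graph_eq_bot [Fintype V] (G : SignedGraph V) (h : G.graph = ⊥)
    {μ : ℝ} (hμ : μ ≠ 0) : ¬G.adjEnd.HasEigenvalue μ := by
  intro he
  obtain ⟨x, hx, hx0⟩ := he.exists_hasEigenvector
  rw [mem_eigenspace_iff_sum] at hx
  refine hx0 (funext fun u => ?_)
  have h0 : ∀ v, G.adjMatrix u v = 0 := fun v => by simp [adjMatrix_eq_zero_iff, h]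
  have := hx u
  simp only [h0, Int.cast_zero, zero_mul, Finset.sum_const_zero] at this
  simpa [hμ] using this.symm

/-- Restriction of the vectors of an eigenspace to a set of vertices. -/
noncomputable def eigenspaceRestrict [Fintype V] (G : SignedGraph V) (μ : ℝ) (S : Finset V) :
    G.adjEnd.eigenspace μ →ₗ[ℝ] ({v // v ∈ S} → ℝ) :=
  (LinearMap.funLeft ℝ ℝ (Subtype.val : {v // v ∈ S} → V)).comp (Submodule.subtype _)

-- An edgeless complement of S makes the eigenvalue equation at h express x h through the values on
-- S; for μ ≠ 0 an eigenvector is then determined by its restriction to S.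
open Classical in
theorem eigenvector_apply_of_notMem [Fintype V] {G : SignedGraph V} {μ : ℝ} {S : Finset V}
    (hout : ∀ u v, u ∉ S → v ∉ S → G.adjMatrix u v = 0) {x : V → ℝ}
    (hx : x ∈ G.adjEnd.eigenspace μ) {h : V} (hh : h ∉ S) :
    μ * x h = ∑ u : {v // v ∈ S}, (G.adjMatrix h u : ℝ) * x u := by
  rw [← (mem_eigenspace_iff_sum G μ x).mp hx h,
    ← Fintype.sum_subtype_add_sum_subtype (· ∈ S)]
  have h0 : ∀ v : {v // v ∉ S}, (G.adjMatrix h v : ℝ) * x v = 0 := fun v => by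
    rw [hout h v hh v.2, Int.cast_zero, zero_mul]
  rw [Finset.sum_congr rfl fun v _ => h0 v, Finset.sum_const_zero, add_zero]
  convert rfl

theorem eigenspaceRestrict_injective [Fintype V] {G : SignedGraph V} {μ : ℝ} (hμ : μ ≠ 0)
    {S : Finset V} (hout : ∀ u v, u ∉ S → v ∉ S → G.adjMatrix u v = 0) :
    Function.Injective (G.eigenspaceRestrict μ S) := by
  rw [injective_iff_map_eq_zero]
  rintro ⟨x, hx⟩ h
  have hS : ∀ u : {v // v ∈ S}, x u = 0 := fun u => congrFun h u
  refine Subtype.ext (funext fun v => ?_)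
  by_cases hv : v ∈ S
  · exact hS ⟨v, hv⟩
  · have := eigenvector_apply_of_notMem hout hx hv
    simp only [hS, mul_zero, Finset.sum_const_zero] at this
    simpa [hμ] using this

open Classical in
/-- The reconstruction equation for a totally disconnected star complement. -/
theorem reconstruction [Fintype V] {G : SignedGraph V} {μ : ℝ} (hμ : μ ≠ 0)
    {S : Finset V} (hout : ∀ u v, u ∉ S → v ∉ S → G.adjMatrix u v = 0)
    (hcard : S.card = Module.finrank ℝ (G.adjEnd.eigenspace μ)) (u v : V) (hu : u ∈ S)
    (hv : v ∈ S) :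
    μ * (G.adjMatrix u v : ℝ) +
      ∑ h : {h // h ∉ S}, (G.adjMatrix u h : ℝ) * (G.adjMatrix v h : ℝ) =
      if u = v then μ ^ 2 else 0 := by
  -- The star set has as many elements as the eigenspace has dimensions, so injectivity of the
  -- restriction gives surjectivity.
  have hsurj : Function.Surjective (G.eigenspaceRestrict μ S) := by
    refine (LinearMap.injective_iff_surjective_of_finrank_eq_finrank ?_).mp
      (eigenspaceRestrict_injective hμ hout)
    rw [← hcard, Module.finrank_fintype_fun_eq_card, Fintype.card_coe]
  -- Take the eigenvector that is the indicator of v on S. Off S its values are A_vh / μ, and its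
  -- eigenvalue equation at u, times μ, is the claim.
  obtain ⟨⟨x, hx⟩, hxv⟩ := hsurj (Pi.single ⟨v, hv⟩ 1)
  have hxS : ∀ w : {w // w ∈ S}, x w = if w = ⟨v, hv⟩ then 1 else 0 := fun w => by
    have := congrFun hxv w
    rwa [Pi.single_apply] at this
  have hxH : ∀ h : {h // h ∉ S}, μ * x h = G.adjMatrix v h := fun h => by
    rw [eigenvector_apply_of_notMem hout hx h.2]
    simp only [hxS, mul_ite, mul_one, mul_zero, Finset.sum_ite_eq', Finset.mem_univ, if_true]
    rw [G.adjMatrix_comm]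
  have hrow := (mem_eigenspace_iff_sum G μ x).mp hx u
  rw [← Fintype.sum_subtype_add_sum_subtype (· ∈ S)] at hrow
  have hxu : x u = if u = v then 1 else 0 := by
    simpa [Subtype.ext_iff] using hxS ⟨u, hu⟩
  simp only [hxS, mul_ite, mul_one, mul_zero, Finset.sum_ite_eq', Finset.mem_univ, if_true,
    hxu] at hrow
  simp only [← hxH]
  have : ∑ h : {h // h ∉ S}, (G.adjMatrix u h : ℝ) * (μ * x h) =
      μ * ∑ h : {h // h ∉ S}, (G.adjMatrix u h : ℝ) * x h := by
    rw [Finset.mul_sum]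
    exact Finset.sum_congr rfl fun h _ => by ring
  rw [this, ← mul_add, hrow]
  split_ifs <;> ring

end SignedGraph

/-- A `{0, 1, -1}`-matrix whose rows are pairwise orthogonal and have `m` nonzero entries each. -/
structure IsPartialWeighing {κ ι : Type*} [Fintype ι] (B : Matrix κ ι ℤ) (m : ℕ) : Prop where
  entry : ∀ u i, B u i = 0 ∨ B u i = 1 ∨ B u i = -1
  sum_sq : ∀ u, ∑ i, B u i * B u i = m
  orthogonal : ∀ u v, u ≠ v → ∑ i, B u i * B v i = 0

/-! ### Star sets correspond to partial weighing matrices. -/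

namespace SignedGraph

variable {V : Type*}

/-- The part of the adjacency matrix with rows in `S` and columns outside `S`. -/
noncomputable def crossMatrix (G : SignedGraph V) (S : Finset V) :
    Matrix {v // v ∈ S} {v // v ∉ S} ℤ :=
  G.adjMatrix.submatrix Subtype.val Subtype.val

theorem crossMatrix_apply (G : SignedGraph V) (S : Finset V) (u : {v // v ∈ S})
    (h : {v // v ∉ S}) : G.crossMatrix S u h = G.adjMatrix u h := rfl

open Classical in
/-- The graph is bipartite with parts `S` and its complement, and its bipartite adjacency matrix
has pairwise orthogonal rows with `m` nonzero entries. -/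
structure IsWeighingSet [Fintype V] (G : SignedGraph V) (S : Finset V) (m : ℕ) : Prop where
  inside : ∀ u v, u ∈ S → v ∈ S → G.adjMatrix u v = 0
  outside : ∀ u v, u ∉ S → v ∉ S → G.adjMatrix u v = 0
  weighing : IsPartialWeighing (G.crossMatrix S) m

theorem IsStarSet.isWeighingSet [Fintype V] {G : SignedGraph V} (hbip : G.graph.IsBipartite)
    {μ : ℝ} {m : ℕ} (hμ : μ ^ 2 = m) (hm : 2 ≤ m) {S : Finset V} (hS : G.IsStarSet μ S)
    (hbot : (G.induce {v | v ∉ S}).graph = ⊥) (hcard : Nat.card {v // v ∉ S} = m + 1) :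
    G.IsWeighingSet S m := by
  classical
  have hμ0 : μ ≠ 0 := by
    rintro rfl
    have : (m : ℝ) ≠ 0 := by positivity
    simp at hμ
    exact this hμ.symm
  have hout : ∀ u v, u ∉ S → v ∉ S → G.adjMatrix u v = 0 := by
    intro u v hu hv
    have := adjMatrix_induce G {v | v ∉ S} ⟨u, hu⟩ ⟨v, hv⟩
    rw [← this, adjMatrix_eq_zero_iff, hbot]
    exact fun h => h
  have hrec := reconstruction hμ0 hout hS.2.1
  have hsq : ∀ u, u ∈ S → ∑ h : {h // h ∉ S}, G.adjMatrix u h * G.adjMatrix u h = m := by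
    intro u hu
    have := hrec u u hu hu
    rw [adjMatrix_self, if_pos rfl, hμ] at this
    simp only [Int.cast_zero, mul_zero, zero_add] at this
    exact_mod_cast this
  have hin : ∀ u v, u ∈ S → v ∈ S → G.adjMatrix u v = 0 := by
    intro u v hu hv
    -- An edge uv in S lies in no triangle, so u and v have disjoint neighbourhoods outside S. Both
    -- have m elements, whence 2m ≤ m + 1, against m ≥ 2.
    by_contra huv
    have hdisj : ∀ h : {h // h ∉ S}, G.adjMatrix u h = 0 ∨ G.adjMatrix v h = 0 := by
      intro h
      by_contra hne
      push Not at hne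
      obtain ⟨c⟩ := hbip
      have h1 : c u ≠ c v := c.valid ((adj_iff_adjMatrix_ne_zero G u v).mpr huv)
      have h2 : c u ≠ c h := c.valid ((adj_iff_adjMatrix_ne_zero G u h).mpr hne.1)
      have h3 : c v ≠ c h := c.valid ((adj_iff_adjMatrix_ne_zero G v h).mpr hne.2)
      omega
    have hle : ∀ h : {h // h ∉ S},
        G.adjMatrix u h * G.adjMatrix u h + G.adjMatrix v h * G.adjMatrix v h ≤ 1 := by
      intro h
      rcases hdisj h with h0 | h0
      · rcases G.adjMatrix_entry v h with h1 | h1 | h1 <;> simp [h0, h1]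
      · rcases G.adjMatrix_entry u h with h1 | h1 | h1 <;> simp [h0, h1]
    have hsum := Finset.sum_le_sum fun h (_ : h ∈ Finset.univ) => hle h
    rw [Finset.sum_add_distrib, hsq u hu, hsq v hv, Finset.sum_const, Finset.card_univ,
      ← Nat.card_eq_fintype_card, hcard] at hsum
    simp at hsum
    omega
  refine ⟨hin, hout, fun _ _ => G.adjMatrix_entry _ _, fun u => ?_, fun u v huv => ?_⟩
  · simp only [crossMatrix_apply]
    convert hsq u u.2
  · have := hrec u v u.2 v.2
    rw [hin u v u.2 v.2, if_neg fun h => huv (Subtype.ext h)] at this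
    simp only [Int.cast_zero, mul_zero, zero_add] at this
    simp only [crossMatrix_apply]
    exact_mod_cast this

theorem IsWeighingSet.isBipartite [Fintype V] {G : SignedGraph V} {S : Finset V} {m : ℕ}
    (h : G.IsWeighingSet S m) : G.graph.IsBipartite := by
  classical
  refine ⟨SimpleGraph.Coloring.mk (fun v => if v ∈ S then 0 else 1) fun {u v} huv => ?_⟩
  rw [adj_iff_adjMatrix_ne_zero] at huv
  by_cases hu : u ∈ S <;> by_cases hv : v ∈ S
  · exact (huv (h.inside u v hu hv)).elim
  · simp [hu, hv]
  · simp [hu, hv]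
  · exact (huv (h.outside u v hu hv)).elim

/-- Any vector y on S extends by μ⁻¹Bᵀy to an eigenvector, because BBᵀ = μ² I. The eigenspace thus
has dimension |S|, and S must be nonempty for μ to be an eigenvalue. -/
theorem IsWeighingSet.hasTotallyDisconnectedStarComplement [Fintype V] {G : SignedGraph V}
    {S : Finset V} {m : ℕ} (h : G.IsWeighingSet S m) (hne : S.Nonempty) {μ : ℝ}
    (hμ : μ ^ 2 = m) (hμ0 : μ ≠ 0) :
    G.HasTotallyDisconnectedStarComplement μ (Nat.card {v // v ∉ S}) := by
  classical
  have hbot : (G.induce {v | v ∉ S}).graph = ⊥ := by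
    ext u v
    rw [adj_iff_adjMatrix_ne_zero, adjMatrix_induce, h.outside u v u.2 v.2]
    simp
  have hinj := eigenspaceRestrict_injective hμ0 h.outside
  have hsurj : Function.Surjective (G.eigenspaceRestrict μ S) := by
    intro y
    let x : V → ℝ := fun v => if hv : v ∈ S then y ⟨v, hv⟩ else
      μ⁻¹ * ∑ u : {u // u ∈ S}, (G.adjMatrix v u : ℝ) * y u
    have hxS : ∀ u : {v // v ∈ S}, x u = y u := fun u => by simp [x]
    have hxH : ∀ v : {v // v ∉ S}, x v =
        μ⁻¹ * ∑ u : {u // u ∈ S}, (G.adjMatrix v u : ℝ) * y u := fun v => by simp [x, v.2]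
    refine ⟨⟨x, ?_⟩, funext hxS⟩
    rw [mem_eigenspace_iff_sum]
    intro v
    rw [← Fintype.sum_subtype_add_sum_subtype (· ∈ S)]
    by_cases hv : v ∈ S
    · have h1 : ∀ u : {u // u ∈ S}, (G.adjMatrix v u : ℝ) * x u = 0 := fun u => by
        rw [h.inside v u hv u.2, Int.cast_zero, zero_mul]
      have h2 : ∀ u : {u // u ∈ S}, ∑ w : {w // w ∉ S},
          (G.adjMatrix v w : ℝ) * G.adjMatrix w u = if u = ⟨v, hv⟩ then (m : ℝ) else 0 := by
        intro u
        split_ifs with huv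
        · have := h.weighing.sum_sq ⟨v, hv⟩
          subst huv
          simp only [crossMatrix_apply] at this
          simp only [G.adjMatrix_comm _ v]
          exact_mod_cast this
        · have := h.weighing.orthogonal ⟨v, hv⟩ u (Ne.symm huv)
          simp only [crossMatrix_apply] at this
          simp only [G.adjMatrix_comm _ u]
          exact_mod_cast this
      have h3 : ∑ w : {w // w ∉ S}, (G.adjMatrix v w : ℝ) * x w =
          μ⁻¹ * ∑ u : {u // u ∈ S}, (∑ w : {w // w ∉ S},
            (G.adjMatrix v w : ℝ) * G.adjMatrix w u) * y u := by
        simp only [hxH, Finset.mul_sum, Finset.sum_mul]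
        rw [Finset.sum_comm]
        exact Finset.sum_congr rfl fun u _ => Finset.sum_congr rfl fun w _ => by ring
      rw [Finset.sum_congr rfl fun u _ => h1 u, Finset.sum_const_zero, zero_add, h3]
      simp only [h2, ite_mul, zero_mul, Finset.sum_ite_eq', Finset.mem_univ, if_true]
      rw [hxS ⟨v, hv⟩, ← hμ]
      field_simp
    · have h1 : ∀ u : {u // u ∉ S}, (G.adjMatrix v u : ℝ) * x u = 0 := fun u => by
        rw [h.outside v u hv u.2, Int.cast_zero, zero_mul]
      rw [Finset.sum_congr rfl fun (u : {u // u ∉ S}) _ => h1 u, Finset.sum_const_zero, add_zero,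
        hxH ⟨v, hv⟩]
      simp only [hxS]
      field_simp
      convert rfl
  have hfr : Module.finrank ℝ (G.adjEnd.eigenspace μ) = S.card := by
    rw [(LinearEquiv.ofBijective _ ⟨hinj, hsurj⟩).finrank_eq, Module.finrank_fintype_fun_eq_card,
      Fintype.card_coe]
  refine ⟨S, ⟨?_, hfr.symm, not_hasEigenvalue_of_graph_eq_bot _ hbot hμ0⟩, hbot, rfl⟩
  rw [Module.End.hasEigenvalue_iff]
  intro he
  rw [he, finrank_bot] at hfr
  exact hne.card_pos.ne hfr

end SignedGraph

/-! ### Partial weighing matrices -/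

namespace IsPartialWeighing

variable {κ ι : Type*} [Fintype ι] {B : Matrix κ ι ℤ} {m : ℕ}

theorem submatrix {κ' ι' : Type*} [Fintype ι'] (h : IsPartialWeighing B m) {e : κ' → κ}
    (he : Function.Injective e) (f : ι' ≃ ι) : IsPartialWeighing (B.submatrix e f) m where
  entry _ _ := h.entry _ _
  sum_sq u := (f.sum_comp fun i => B (e u) i * B (e u) i).trans (h.sum_sq _)
  orthogonal u v huv :=
    (f.sum_comp fun i => B (e u) i * B (e v) i).trans (h.orthogonal _ _ (he.ne huv))

theorem sum_eq_ite [DecidableEq κ] (h : IsPartialWeighing B m) (u v : κ) :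
    ∑ i, B u i * B v i = if u = v then (m : ℤ) else 0 := by
  split_ifs with huv
  · rw [← huv, h.sum_sq]
  · exact h.orthogonal u v huv

theorem mul_smul_transpose_eq_one [DecidableEq κ] (h : IsPartialWeighing B m) (hm : m ≠ 0) :
    B.map (Int.cast : ℤ → ℚ) * ((m : ℚ)⁻¹ • (B.map (Int.cast : ℤ → ℚ)).transpose) = 1 := by
  have hm' : (m : ℚ) ≠ 0 := by exact_mod_cast hm
  ext u v
  have := h.sum_eq_ite u v
  have hq : ∑ i, (B u i : ℚ) * B v i = if u = v then (m : ℚ) else 0 := by exact_mod_cast this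
  rw [Matrix.mul_smul, Matrix.smul_apply, Matrix.mul_apply]
  simp only [Matrix.map_apply, Matrix.transpose_apply, hq, Matrix.one_apply]
  split_ifs <;> simp [hm']

theorem card_le [Fintype κ] (h : IsPartialWeighing B m) (hm : m ≠ 0) :
    Fintype.card κ ≤ Fintype.card ι := by
  classical
  have h1 := Matrix.rank_mul_le_left (B.map (Int.cast : ℤ → ℚ))
    ((m : ℚ)⁻¹ • (B.map (Int.cast : ℤ → ℚ)).transpose)
  rw [h.mul_smul_transpose_eq_one hm, Matrix.rank_one] at h1
  exact h1.trans (Matrix.rank_le_card_width _)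

/-- A one-sided inverse of a square matrix is two-sided, so BBᵀ = m I gives BᵀB = m I. -/
theorem sum_column_eq_ite [Fintype κ] [DecidableEq ι] (h : IsPartialWeighing B m) (hm : m ≠ 0)
    (hcard : Fintype.card κ = Fintype.card ι) (i j : ι) :
    ∑ u, B u i * B u j = if i = j then (m : ℤ) else 0 := by
  classical
  have hm' : (m : ℚ) ≠ 0 := by exact_mod_cast hm
  have h1 := (Matrix.mul_eq_one_comm_of_equiv (Fintype.equivOfCardEq hcard)).mp
    (h.mul_smul_transpose_eq_one hm)
  have h2 := congrFun (congrFun h1 i) j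
  rw [Matrix.smul_mul, Matrix.smul_apply, Matrix.mul_apply] at h2
  simp only [Matrix.map_apply, Matrix.transpose_apply, Matrix.one_apply, smul_eq_mul] at h2
  rw [inv_mul_eq_iff_eq_mul₀ hm', mul_ite, mul_one, mul_zero] at h2
  exact_mod_cast h2

theorem exists_zero (h : IsPartialWeighing B m) (hcard : Fintype.card ι = m + 1) :
    ∃ z : κ → ι, ∀ u i, B u i = 0 ↔ i = z u := by
  classical
  have key : ∀ u, ∃ j, ∀ i, B u i = 0 ↔ i = j := by
    intro u
    have h1 : ∀ i, B u i * B u i = 1 - if B u i = 0 then 1 else 0 := by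
      intro i
      rcases h.entry u i with h0 | h0 | h0 <;> simp [h0]
    have h2 := h.sum_sq u
    rw [Finset.sum_congr rfl fun i _ => h1 i, Finset.sum_sub_distrib, Finset.sum_boole] at h2
    simp only [Finset.sum_const, Finset.card_univ, hcard, nsmul_eq_mul, mul_one] at h2
    push_cast at h2
    have h3 : (Finset.univ.filter fun i => B u i = 0).card = 1 := by omega
    obtain ⟨j, hj⟩ := Finset.card_eq_one.mp h3
    refine ⟨j, fun i => ?_⟩
    have := Finset.ext_iff.mp hj i
    simpa using this
  choose z hz using key
  exact ⟨z, hz⟩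

/-- Rows vanishing in different columns would overlap in m - 1 places, and a sum of an odd number of
signs is not zero. -/
theorem zero_eq_of_even (h : IsPartialWeighing B m) (hcard : Fintype.card ι = m + 1)
    (hm : Even m) {z : κ → ι} (hz : ∀ u i, B u i = 0 ↔ i = z u) (u v : κ) : z u = z v := by
  classical
  by_contra hne
  have huv : u ≠ v := fun huv => hne (by rw [huv])
  -- The subtracted term is the indicator of the columns where both rows are nonzero.
  have hpar : ∀ i, (2 : ℤ) ∣ B u i * B v i -
      (1 - (if i = z u then 1 else 0) - (if i = z v then 1 else 0)) := by
    intro i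
    have hu := hz u i
    have hv := hz v i
    by_cases h1 : i = z u
    · have h2 : i ≠ z v := fun h2 => hne (h1.symm.trans h2)
      rw [hu.mpr h1, if_pos h1, if_neg h2]
      simp
    · by_cases h2 : i = z v
      · rw [hv.mpr h2, if_neg h1, if_pos h2]
        simp
      · have h3 := (h.entry u i).resolve_left (mt hu.mp h1)
        have h4 := (h.entry v i).resolve_left (mt hv.mp h2)
        rcases h3 with h3 | h3 <;> rcases h4 with h4 | h4 <;> simp [h1, h2, h3, h4]
  have hsum := Finset.dvd_sum fun i (_ : i ∈ Finset.univ) => hpar i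
  rw [Finset.sum_sub_distrib, h.orthogonal u v huv, Finset.sum_sub_distrib,
    Finset.sum_sub_distrib] at hsum
  simp [hcard] at hsum
  obtain ⟨t, rfl⟩ := hm
  omega

/-- Sums of two signs are even, so each (B u i + B v i)(B u i + B w i) is divisible by 4; by
orthogonality these products add up to m. -/
theorem four_dvd (h : IsPartialWeighing B m) {j : ι} (hz : ∀ u i, B u i = 0 ↔ i = j)
    {u v w : κ} (huv : u ≠ v) (huw : u ≠ w) (hvw : v ≠ w) : 4 ∣ m := by
  have hdvd : ∀ i, (4 : ℤ) ∣ (B u i + B v i) * (B u i + B w i) := by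
    intro i
    by_cases hi : i = j
    · simp [(hz u i).mpr hi, (hz v i).mpr hi]
    · have h1 := (h.entry u i).resolve_left (mt (hz u i).mp hi)
      have h2 := (h.entry v i).resolve_left (mt (hz v i).mp hi)
      have h3 := (h.entry w i).resolve_left (mt (hz w i).mp hi)
      rcases h1 with h1 | h1 <;> rcases h2 with h2 | h2 <;> rcases h3 with h3 | h3 <;>
        simp [h1, h2, h3]
  have hsum := Finset.dvd_sum fun i (_ : i ∈ Finset.univ) => hdvd i
  have h1 : ∑ i, (B u i + B v i) * (B u i + B w i) = m := by
    have h2 : ∀ i, (B u i + B v i) * (B u i + B w i) =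
        B u i * B u i + B u i * B w i + B v i * B u i + B v i * B w i := fun i => by ring
    rw [Finset.sum_congr rfl fun i _ => h2 i, Finset.sum_add_distrib, Finset.sum_add_distrib,
      Finset.sum_add_distrib, h.sum_sq, h.orthogonal u w huw, h.orthogonal v u huv.symm,
      h.orthogonal v w hvw]
    ring
  rw [h1] at hsum
  exact_mod_cast hsum

theorem deleteColumn [DecidableEq ι] (h : IsPartialWeighing B m) {j : ι} (hj : ∀ u, B u j = 0) :
    IsPartialWeighing (B.submatrix id (Subtype.val : {i // i ≠ j} → ι)) m := by
  have key : ∀ u v, ∑ i : {i // i ≠ j}, B u i * B v i = ∑ i, B u i * B v i := by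
    intro u v
    rw [← Fintype.sum_subtype_add_sum_subtype (· ≠ j) (fun i => B u i * B v i)]
    have h0 : ∀ i : {i // ¬i ≠ j}, B u i * B v i = 0 := fun i => by
      rw [not_not.mp i.2, hj, zero_mul]
    rw [Finset.sum_congr rfl fun i _ => h0 i, Finset.sum_const_zero, add_zero]
  exact ⟨fun u i => h.entry _ _, fun u => (key u u).trans (h.sum_sq u),
    fun u v huv => (key u v).trans (h.orthogonal u v huv)⟩

end IsPartialWeighing

/-- Place t copies of a Hadamard matrix side by side and add a zero column. The cases used are n =
1, n = 2 and n = m. -/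
theorem IsHadamardOrder.exists_partialWeighing {n t m : ℕ} (hn : IsHadamardOrder n)
    (hm : n * t = m) : ∃ B : Matrix (Fin n) (Fin (m + 1)) ℤ, IsPartialWeighing B m := by
  subst hm
  obtain ⟨H, hH⟩ := hn
  have hpm : ∀ i j, H i j = 1 ∨ H i j = -1 := fun i j =>
    Unitary.mem_iff_eq_one_or_eq_neg_one.mp (hH.apply_mem i j)
  have hHH : ∀ u v, ∑ j, H u j * H v j = if u = v then (n : ℤ) else 0 := by
    intro u v
    have := congrFun (congrFun hH.mul_conjTranspose u) v
    rw [Matrix.mul_apply, Matrix.smul_apply, Matrix.one_apply] at this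
    simpa using this
  let B : Matrix (Fin n) (Option (Fin n × Fin t)) ℤ :=
    Matrix.of fun u i => i.elim 0 fun p => H u p.1
  have hsum : ∀ u v, ∑ i, B u i * B v i = if u = v then ((n * t : ℕ) : ℤ) else 0 := by
    intro u v
    rw [Fintype.sum_option, Fintype.sum_prod_type]
    have h1 : ∀ x : Fin n, ∑ y : Fin t, B u (some (x, y)) * B v (some (x, y)) =
        t * (H u x * H v x) := fun x => by simp [B]
    rw [Finset.sum_congr rfl fun x _ => h1 x, ← Finset.mul_sum, hHH]
    split_ifs <;> simp [B, mul_comm]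
  have hB : IsPartialWeighing B (n * t) := by
    refine ⟨fun u i => ?_, fun u => by rw [hsum, if_pos rfl],
      fun u v huv => by rw [hsum, if_neg huv]⟩
    cases i with
    | none => exact Or.inl rfl
    | some p => exact Or.inr (hpm u p.1)
  exact ⟨_, hB.submatrix Function.injective_id (Fintype.equivFinOfCardEq (by simp)).symm⟩

theorem exists_partialWeighing_of_odd_primePow {q : ℕ} (hq : IsPrimePow q) (hodd : Odd q) :
    ∃ B : Matrix (Fin (q + 1)) (Fin (q + 1)) ℤ, IsPartialWeighing B q := by
  obtain ⟨C, hC, hCC⟩ := exists_conference_of_odd_primePow hq hodd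
  have hsum : ∀ u v, ∑ j, C u j * C v j = if u = v then (q : ℤ) else 0 := by
    intro u v
    have := congrFun (congrFun hCC u) v
    rw [Matrix.mul_apply, Matrix.smul_apply, Matrix.one_apply] at this
    simpa using this
  exact ⟨C, hC, fun u => by rw [hsum, if_pos rfl], fun u v huv => by rw [hsum, if_neg huv]⟩

/-- Serves to number the large part of K_{2,m} so that the negative edges come first, as `signedK₂`
requires. -/
theorem exists_equiv_fin_iff_lt {α : Type*} [Fintype α] {p : α → Prop} [DecidablePred p]
    {n a : ℕ} (hn : Fintype.card α = n) (ha : Fintype.card {x // p x} = a) :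
    ∃ e : α ≃ Fin n, ∀ x, p x ↔ (e x : ℕ) < a := by
  have hle : a ≤ n := by
    rw [← ha, ← hn]
    exact Fintype.card_subtype_le p
  have h1 : Fintype.card {j : Fin n // (j : ℕ) < a} = a := by
    rw [Fintype.card_subtype]
    simp [Fin.card_filter_val_lt, hle]
  have h2 : Fintype.card {x // ¬p x} = Fintype.card {j : Fin n // ¬(j : ℕ) < a} := by
    rw [Fintype.card_subtype_compl, Fintype.card_subtype_compl, ha, h1, hn, Fintype.card_fin]
  let e₁ : {x // p x} ≃ {j : Fin n // (j : ℕ) < a} := Fintype.equivOfCardEq (ha.trans h1.symm)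
  let e₂ : {x // ¬p x} ≃ {j : Fin n // ¬(j : ℕ) < a} := Fintype.equivOfCardEq h2
  refine ⟨(Equiv.sumCompl p).symm.trans ((e₁.sumCongr e₂).trans (Equiv.sumCompl _)), fun x => ?_⟩
  by_cases hx : p x
  · have := (e₁ ⟨x, hx⟩).2
    simpa [Equiv.sumCompl_symm_apply_of_pos hx, hx] using this
  · have := (e₂ ⟨x, hx⟩).2
    simpa [Equiv.sumCompl_symm_apply_of_neg hx, hx] using this

/-! ### Maximal bipartite signed graphs -/

namespace SignedGraph

variable {V W : Type*}

/-- The signed graph whose adjacency matrix is pulled back along a map of vertex sets. -/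
noncomputable def comap (G : SignedGraph V) (f : W → V) : SignedGraph W :=
  ofMatrix (G.adjMatrix.submatrix f f) (fun _ _ => G.adjMatrix_comm _ _)
    (fun _ => G.adjMatrix_self _)

theorem adjMatrix_comap (G : SignedGraph V) (f : W → V) (u v : W) :
    (G.comap f).adjMatrix u v = G.adjMatrix (f u) (f v) := by
  exact congrFun (congrFun (adjMatrix_ofMatrix (G.adjMatrix.submatrix f f)
    (fun _ _ => G.adjMatrix_comm _ _) (fun _ => G.adjMatrix_self _)
    fun _ _ => G.adjMatrix_entry _ _) u) v

open Classical in
theorem sum_crossMatrix_rows [Fintype V] {G : SignedGraph V} {S : Finset V}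
    (hin : ∀ u v, u ∈ S → v ∈ S → G.adjMatrix u v = 0) (u v : {v // v ∈ S}) :
    ∑ h, G.crossMatrix S u h * G.crossMatrix S v h =
      ∑ w, G.adjMatrix u w * G.adjMatrix v w := by
  rw [← Fintype.sum_subtype_add_sum_subtype (· ∈ S)]
  have h0 : ∀ w : {w // w ∈ S}, G.adjMatrix u w * G.adjMatrix v w = 0 := fun w => by
    rw [hin u w u.2 w.2, zero_mul]
  rw [Finset.sum_congr rfl fun w _ => h0 w, Finset.sum_const_zero, zero_add]
  rfl

open Classical in
theorem sum_crossMatrix_columns [Fintype V] {G : SignedGraph V} {S : Finset V}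
    (hout : ∀ u v, u ∉ S → v ∉ S → G.adjMatrix u v = 0) (u v : {v // v ∉ S}) :
    ∑ w, G.crossMatrix S w u * G.crossMatrix S w v =
      ∑ w, G.adjMatrix u w * G.adjMatrix w v := by
  rw [← Fintype.sum_subtype_add_sum_subtype (· ∈ S)]
  have h0 : ∀ w : {w // w ∉ S}, G.adjMatrix u w * G.adjMatrix w v = 0 := fun w => by
    rw [hout u w u.2 w.2, zero_mul]
  rw [Finset.sum_congr rfl fun (w : {w // w ∉ S}) _ => h0 w, Finset.sum_const_zero, add_zero]
  simp only [crossMatrix_apply, G.adjMatrix_comm _ u]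
  convert rfl

-- A² is block diagonal with blocks BBᵀ and BᵀB. The set T allows the isolated vertex, whose column
-- of B is zero, to be left out.
open Classical in
theorem IsWeighingSet.sum_adjMatrix [Fintype V] {G : SignedGraph V} {S : Finset V} {m : ℕ}
    (h : G.IsWeighingSet S m) {T : Set V}
    (hT : ∀ u v : {v // v ∉ S}, (u : V) ∈ T → (v : V) ∈ T →
      ∑ w, G.crossMatrix S w u * G.crossMatrix S w v = if u = v then (m : ℤ) else 0)
    (u v : V) (hu : u ∈ T) (hv : v ∈ T) :
    ∑ w, G.adjMatrix u w * G.adjMatrix w v = if u = v then (m : ℤ) else 0 := by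
  by_cases huS : u ∈ S <;> by_cases hvS : v ∈ S
  · have h1 := sum_crossMatrix_rows h.inside ⟨u, huS⟩ ⟨v, hvS⟩
    rw [h.weighing.sum_eq_ite] at h1
    simp only [G.adjMatrix_comm _ v]
    rw [← h1]
    simp
  · rw [if_neg fun huv : u = v => hvS (huv ▸ huS)]
    refine Finset.sum_eq_zero fun w _ => ?_
    by_cases hw : w ∈ S
    · rw [h.inside u w huS hw, zero_mul]
    · rw [h.outside w v hw hvS, mul_zero]
  · rw [if_neg fun huv : u = v => huS (huv ▸ hvS)]
    refine Finset.sum_eq_zero fun w _ => ?_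
    by_cases hw : w ∈ S
    · rw [h.inside w v hw hvS, mul_zero]
    · rw [h.outside u w huS hw, zero_mul]
  · have h1 := sum_crossMatrix_columns h.outside ⟨u, huS⟩ ⟨v, hvS⟩
    rw [hT _ _ hu hv] at h1
    rw [← h1]
    simp

/-- The graph has adjacency matrix with blocks 0, B, Bᵀ, 0, and the k rows of B form the star set.
-/
theorem exists_isBipartite_of_partialWeighing [Fintype V] {k m : ℕ}
    (e : Fin k ⊕ Fin (m + 1) ≃ V) (hk : 0 < k)
    {B : Matrix (Fin k) (Fin (m + 1)) ℤ} (hB : IsPartialWeighing B m) {μ : ℝ}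
    (hμ : μ ^ 2 = m) (hμ0 : μ ≠ 0) :
    ∃ G : SignedGraph V, G.graph.IsBipartite ∧
      G.HasTotallyDisconnectedStarComplement μ (m + 1) := by
  classical
  let M : Matrix (Fin k ⊕ Fin (m + 1)) (Fin k ⊕ Fin (m + 1)) ℤ :=
    Matrix.fromBlocks 0 B B.transpose 0
  have hsymm : ∀ u v, M u v = M v u := by
    rintro (u | u) (v | v) <;> rfl
  have h0 : ∀ u, M u u = 0 := by
    rintro (u | u) <;> rfl
  have hent : ∀ u v, M u v = 0 ∨ M u v = 1 ∨ M u v = -1 := by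
    rintro (u | u) (v | v)
    · exact Or.inl rfl
    · exact hB.entry u v
    · exact hB.entry v u
    · exact Or.inl rfl
  let G : SignedGraph (V) := (ofMatrix M hsymm h0).comap e.symm
  have hG : ∀ u v, G.adjMatrix u v = M (e.symm u) (e.symm v) := fun u v => by
    rw [adjMatrix_comap, adjMatrix_ofMatrix M hsymm h0 hent]
  let S : Finset (V) := Finset.univ.image fun i : Fin k => e (Sum.inl i)
  have hS : ∀ u, u ∈ S ↔ ∃ i, e.symm u = Sum.inl i := by
    intro u
    simp only [S, Finset.mem_image, Finset.mem_univ, true_and, Equiv.symm_apply_eq]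
    exact exists_congr fun i => eq_comm
  have hS' : ∀ u, u ∉ S → ∃ i, e.symm u = Sum.inr i := by
    intro u hu
    rcases h : e.symm u with i | i
    · exact (hu ((hS u).mpr ⟨i, h⟩)).elim
    · exact ⟨i, rfl⟩
  have hin : ∀ u v, u ∈ S → v ∈ S → G.adjMatrix u v = 0 := by
    intro u v hu hv
    obtain ⟨i, hi⟩ := (hS u).mp hu
    obtain ⟨j, hj⟩ := (hS v).mp hv
    rw [hG, hi, hj]
    rfl
  have hout : ∀ u v, u ∉ S → v ∉ S → G.adjMatrix u v = 0 := by
    intro u v hu hv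
    obtain ⟨i, hi⟩ := hS' u hu
    obtain ⟨j, hj⟩ := hS' v hv
    rw [hG, hi, hj]
    rfl
  have hsum : ∀ (u v : {v // v ∈ S}) (i j : Fin k), e.symm u = Sum.inl i → e.symm v = Sum.inl j →
      ∑ h, G.crossMatrix S u h * G.crossMatrix S v h = ∑ l, B i l * B j l := by
    intro u v i j hi hj
    rw [sum_crossMatrix_rows hin]
    simp only [hG, hi, hj]
    rw [e.symm.sum_comp fun w => M (Sum.inl i) w * M (Sum.inl j) w, Fintype.sum_sum_type]
    simp [M]
  have hW : G.IsWeighingSet S m := by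
    refine ⟨hin, hout, fun _ _ => G.adjMatrix_entry _ _, fun u => ?_, fun u v huv => ?_⟩
    · obtain ⟨i, hi⟩ := (hS u).mp u.2
      rw [hsum u u i i hi hi]
      exact hB.sum_sq i
    · obtain ⟨i, hi⟩ := (hS u).mp u.2
      obtain ⟨j, hj⟩ := (hS v).mp v.2
      rw [hsum u v i j hi hj]
      refine hB.orthogonal i j fun hij => huv (Subtype.ext (e.symm.injective ?_))
      rw [hi, hj, hij]
  have hScard : S.card = k := by
    have hinj : Function.Injective fun i : Fin k => e (Sum.inl i) :=
      e.injective.comp Sum.inl_injective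
    rw [Finset.card_image_of_injective _ hinj, Finset.card_univ, Fintype.card_fin]
  have hcard : Nat.card {v // v ∉ S} = m + 1 := by
    rw [Nat.card_eq_fintype_card, Fintype.card_subtype_compl, Fintype.card_coe, hScard,
      ← Fintype.card_congr e, Fintype.card_sum, Fintype.card_fin, Fintype.card_fin]
    omega
  have h := hW.hasTotallyDisconnectedStarComplement
    (Finset.card_pos.mp (by rw [hScard]; exact hk)) hμ hμ0
  rw [hcard] at h
  exact ⟨G, hW.isBipartite, h⟩

theorem HasTotallyDisconnectedStarComplement.exists_isWeighingSet [Fintype V] {G : SignedGraph V}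
    {m : ℕ} {μ : ℝ} (h : G.HasTotallyDisconnectedStarComplement μ (m + 1))
    (hbip : G.graph.IsBipartite) (hμ : μ ^ 2 = m) (hm : 2 ≤ m) :
    ∃ S : Finset V, G.IsWeighingSet S m ∧ Nat.card {v // v ∉ S} = m + 1 ∧
      Fintype.card V = S.card + (m + 1) := by
  classical
  obtain ⟨S, hS, hbot, hcard⟩ := h
  refine ⟨S, hS.isWeighingSet hbip hμ hm hbot hcard, hcard, ?_⟩
  rw [← hcard, Nat.card_eq_fintype_card, Fintype.card_subtype_compl, Fintype.card_coe]
  have := S.card_le_univ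
  omega

theorem HasTotallyDisconnectedStarComplement.card_le [Fintype V] {G : SignedGraph V}
    {m : ℕ} {μ : ℝ} (h : G.HasTotallyDisconnectedStarComplement μ (m + 1))
    (hbip : G.graph.IsBipartite) (hμ : μ ^ 2 = m) (hm : 2 ≤ m) :
    Fintype.card V ≤ (m + 1) + (m + 1) := by
  classical
  obtain ⟨S, hS, hcard, hV⟩ := h.exists_isWeighingSet hbip hμ hm
  have := hS.weighing.card_le (by omega)
  rw [Fintype.card_coe, ← Nat.card_eq_fintype_card, hcard] at this
  omega

/-- The possible orders are bounded by 2m + 2, and a single row of m ones and a zero shows that some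
order occurs. -/
theorem exists_isMaximalBipartite {m : ℕ} {μ : ℝ} (hμ : μ ^ 2 = m) (hm : 2 ≤ m) (hμ0 : μ ≠ 0) :
    ∃ (n : ℕ) (G : SignedGraph (Fin n)), G.IsMaximalBipartite μ (m + 1) := by
  classical
  let T : Set ℕ := {n | ∃ G : SignedGraph (Fin n), G.graph.IsBipartite ∧
    G.HasTotallyDisconnectedStarComplement μ (m + 1)}
  have hne : T.Nonempty := by
    obtain ⟨B, hB⟩ := isHadamardOrder_one.exists_partialWeighing (one_mul m)
    exact ⟨1 + (m + 1), exists_isBipartite_of_partialWeighing finSumFinEquiv one_pos hB hμ hμ0⟩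
  have hbdd : BddAbove T := by
    refine ⟨(m + 1) + (m + 1), ?_⟩
    rintro n ⟨G, hbip, hG⟩
    simpa using hG.card_le hbip hμ hm
  obtain ⟨G, hbip, hG⟩ := Nat.sSup_mem hne hbdd
  refine ⟨sSup T, G, hbip, hG, fun n G' hbip' hG' => ?_⟩
  rw [Fintype.card_fin]
  exact le_csSup hbdd ⟨G', hbip', hG'⟩

theorem IsMaximalBipartite.card_le [Fintype V] {G : SignedGraph V} {m : ℕ} {μ : ℝ}
    (hG : G.IsMaximalBipartite μ (m + 1)) (hμ : μ ^ 2 = m) (hμ0 : μ ≠ 0) {S : Finset V}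
    (hcard : Fintype.card V = S.card + (m + 1)) {k : ℕ} (hk : 0 < k)
    {B : Matrix (Fin k) (Fin (m + 1)) ℤ} (hB : IsPartialWeighing B m) : k ≤ S.card := by
  obtain ⟨G', hbip, hG'⟩ :=
    exists_isBipartite_of_partialWeighing finSumFinEquiv hk hB hμ hμ0
  have := hG.2.2 _ G' hbip hG'
  omega

/-! ### Identification of the maximal graphs. -/

theorem isSwitchingIsomorphic_comap [Fintype V] (G : SignedGraph V) (f : W ≃ V) :
    G.IsSwitchingIsomorphic (G.comap f) :=
  isSwitchingIsomorphic_of_equiv f (fun _ => 1) (fun _ => Or.inl rfl) fun u v => by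
    rw [adjMatrix_comap, one_mul, mul_one]

theorem IsWeighingSet.exists_isSRG [Fintype V] {G : SignedGraph V} {S : Finset V} {m : ℕ}
    (h : G.IsWeighingSet S m) (hm : 2 ≤ m) (hcard : Nat.card {v // v ∉ S} = m + 1)
    (hV : Fintype.card V = S.card + (m + 1)) (hS : S.card = m + 1) :
    ∃ R : SignedGraph (Fin (2 * m + 2)), R.IsSRG (2 * m + 2) m 0 0 0 ∧
      G.IsSwitchingIsomorphic R := by
  classical
  let e : Fin (2 * m + 2) ≃ V := (Fintype.equivFinOfCardEq (by rw [hV, hS]; ring)).symm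
  have hsum : ∀ u v, ∑ w, G.adjMatrix u w * G.adjMatrix w v = if u = v then (m : ℤ) else 0 := by
    intro u v
    refine h.sum_adjMatrix (T := Set.univ) (fun u v _ _ => ?_) u v trivial trivial
    exact h.weighing.sum_column_eq_ite (by omega)
      (by rw [Fintype.card_coe, hS, ← hcard, Nat.card_eq_fintype_card]) u v
  have hsum' : ∀ u v, ∑ w, (G.comap e).adjMatrix u w * (G.comap e).adjMatrix w v =
      if u = v then (m : ℤ) else 0 := by
    intro u v
    simp only [adjMatrix_comap]
    rw [e.sum_comp fun w => G.adjMatrix (e u) w * G.adjMatrix w (e v), hsum]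
    simp
  exact ⟨G.comap e, isSRG_of_sum_eq _ (Fintype.card_fin _) (by omega) (by omega)
    (fun u => by rw [hsum', if_pos rfl]) (fun u v huv => by rw [hsum', if_neg huv]),
    isSwitchingIsomorphic_comap G e⟩

theorem IsWeighingSet.exists_isolated [Fintype V] {G : SignedGraph V} {S : Finset V} {m : ℕ}
    (h : G.IsWeighingSet S m) (hcard : Nat.card {v // v ∉ S} = m + 1) (hm : Even m)
    (hne : S.Nonempty) : ∃ j : {v // v ∉ S}, ∀ u i, G.crossMatrix S u i = 0 ↔ i = j := by
  classical
  obtain ⟨z, hz⟩ := h.weighing.exists_zero (by rw [← hcard, Nat.card_eq_fintype_card])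
  obtain ⟨u₀, hu₀⟩ := hne
  refine ⟨z ⟨u₀, hu₀⟩, fun u i => ?_⟩
  rw [hz, h.weighing.zero_eq_of_even (by rw [← hcard, Nat.card_eq_fintype_card]) hm hz u]

theorem IsWeighingSet.adjMatrix_isolated [Fintype V] {G : SignedGraph V} {S : Finset V} {m : ℕ}
    (h : G.IsWeighingSet S m) {j : {v // v ∉ S}} (hj : ∀ u, G.crossMatrix S u j = 0) (v : V) :
    G.adjMatrix v j = 0 := by
  by_cases hv : v ∈ S
  · exact hj ⟨v, hv⟩
  · exact h.outside v j hv j.2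

theorem IsWeighingSet.exists_isSRG_disjUnion [Fintype V] {G : SignedGraph V} {S : Finset V}
    {m : ℕ} (h : G.IsWeighingSet S m) (hm : 2 ≤ m) (hcard : Nat.card {v // v ∉ S} = m + 1)
    (hV : Fintype.card V = S.card + (m + 1)) (heven : Even m) (hS : m ≤ S.card) :
    ∃ R : SignedGraph (Fin (2 * m)), R.IsSRG (2 * m) m 0 0 0 ∧
      G.IsSwitchingIsomorphic (R.disjUnion K₁) := by
  classical
  obtain ⟨j, hj⟩ := h.exists_isolated hcard heven (Finset.card_pos.mp (by omega))
  have hj0 := fun u => (hj u j).mpr rfl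
  have hiso := h.adjMatrix_isolated hj0
  have hB := h.weighing.deleteColumn hj0
  have hcard' : Fintype.card {i : {v // v ∉ S} // i ≠ j} = m := by
    have h1 : Fintype.card {i : {v // v ∉ S} // i ≠ j} = Fintype.card {v // v ∉ S} - 1 := by
      rw [Fintype.card_subtype_compl, Fintype.card_subtype_eq]
    rw [h1, ← Nat.card_eq_fintype_card, hcard, Nat.add_sub_cancel]
  -- Without its zero column B has only m columns, so the rank bound improves to |S| ≤ m and B
  -- becomes square.
  have hSm : S.card = m := by
    have := hB.card_le (by omega)
    rw [hcard', Fintype.card_coe] at this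
    omega
  have hcol := hB.sum_column_eq_ite (by omega) (by rw [Fintype.card_coe, hSm, hcard'])
  have hsum : ∀ u v : V, u ≠ j → v ≠ j →
      ∑ w, G.adjMatrix u w * G.adjMatrix w v = if u = v then (m : ℤ) else 0 := by
    intro u v hu hv
    refine h.sum_adjMatrix (T := {v | v ≠ j}) (fun u v hu hv => ?_) u v hu hv
    have := hcol ⟨u, fun h => hu (congrArg Subtype.val h)⟩ ⟨v, fun h => hv (congrArg Subtype.val h)⟩
    simpa using this
  have hVcard : Fintype.card {v : V // v ≠ j} = 2 * m := by
    have h1 : Fintype.card {v : V // v ≠ j} = Fintype.card V - 1 := by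
      rw [Fintype.card_subtype_compl, Fintype.card_subtype_eq]
    omega
  let e : Fin (2 * m) ≃ {v : V // v ≠ j} := (Fintype.equivFinOfCardEq hVcard).symm
  let R : SignedGraph (Fin (2 * m)) := G.comap fun i => (e i : V)
  have hR : ∀ u v, R.adjMatrix u v = G.adjMatrix (e u) (e v) := fun u v => adjMatrix_comap _ _ _ _
  have hsum' : ∀ u v, ∑ w, R.adjMatrix u w * R.adjMatrix w v = if u = v then (m : ℤ) else 0 := by
    intro u v
    simp only [hR]
    rw [e.sum_comp fun w : {v : V // v ≠ j} => G.adjMatrix (e u) w * G.adjMatrix w (e v)]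
    have h1 := hsum _ _ (e u).2 (e v).2
    rw [← Fintype.sum_subtype_add_sum_subtype (· ≠ (j : V))] at h1
    have h0 : ∀ w : {w : V // ¬w ≠ j}, G.adjMatrix (e u) w * G.adjMatrix w (e v) = 0 := fun w => by
      rw [not_not.mp w.2, hiso, zero_mul]
    rw [Finset.sum_congr rfl fun w _ => h0 w, Finset.sum_const_zero, add_zero] at h1
    simpa [Subtype.coe_inj] using h1
  refine ⟨R, isSRG_of_sum_eq _ (Fintype.card_fin _) (by omega) (by omega)
    (fun u => by rw [hsum', if_pos rfl]) (fun u v huv => by rw [hsum', if_neg huv]), ?_⟩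
  let f : Fin (2 * m) ⊕ Fin 1 → V := Sum.elim (fun i => (e i : V)) fun _ => j
  have hf : Function.Bijective f := by
    rw [Fintype.bijective_iff_injective_and_card]
    refine ⟨?_, ?_⟩
    · rintro (a | a) (b | b) hab
      · exact congrArg Sum.inl (e.injective (Subtype.ext hab))
      · exact ((e a).2 hab).elim
      · exact ((e b).2 hab.symm).elim
      · exact congrArg Sum.inr (Subsingleton.elim a b)
    · rw [Fintype.card_sum, Fintype.card_fin, Fintype.card_fin, hV, hSm]
      omega
  refine isSwitchingIsomorphic_of_equiv (Equiv.ofBijective f hf) (fun _ => 1)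
    (fun _ => Or.inl rfl) fun u v => ?_
  rw [adjMatrix_disjUnion, one_mul, mul_one, Equiv.ofBijective_apply, Equiv.ofBijective_apply]
  rcases u with u | u <;> rcases v with v | v
  · exact hR u v
  · exact (hiso _).symm
  · exact ((G.adjMatrix_comm _ _).trans (hiso _)).symm
  · rw [Matrix.fromBlocks_apply₂₂, Subsingleton.elim u v, adjMatrix_self, adjMatrix_self]

theorem adjMatrix_signedK₂_inl_inl (m : ℕ) (a b : Fin 2) :
    (signedK₂ m).adjMatrix (Sum.inl a) (Sum.inl b) = 0 := by
  rw [adjMatrix_eq_zero_iff]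
  simp [signedK₂]

theorem adjMatrix_signedK₂_inr_inr (m : ℕ) (a b : Fin m) :
    (signedK₂ m).adjMatrix (Sum.inr a) (Sum.inr b) = 0 := by
  rw [adjMatrix_eq_zero_iff]
  simp [signedK₂]

theorem adjMatrix_signedK₂_inl_inr (m : ℕ) (a : Fin 2) (b : Fin m) :
    (signedK₂ m).adjMatrix (Sum.inl a) (Sum.inr b) =
      if a = 1 ∧ (b : ℕ) < m / 2 then -1 else 1 := by
  have hadj : (signedK₂ m).graph.Adj (Sum.inl a) (Sum.inr b) := by simp [signedK₂]
  have hneg : s(Sum.inl a, Sum.inr b) ∈ (signedK₂ m).neg ↔ a = 1 ∧ (b : ℕ) < m / 2 := by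
    constructor
    · rintro ⟨j, hj, h⟩
      simp only [Sym2.eq_iff, Sum.inl.injEq, Sum.inr.injEq, reduceCtorEq, and_self,
        or_false] at h
      exact ⟨h.1, h.2 ▸ hj⟩
    · rintro ⟨rfl, hb⟩
      exact ⟨b, hb, rfl⟩
  split_ifs with h
  · exact (negAdj_iff _ _ _).mp ⟨hadj, hneg.mpr h⟩
  · exact (posAdj_iff _ _ _).mp ⟨hadj, mt hneg.mp h⟩

/-- A third row would force 4 ∣ m. With two rows, switching the other part by the signs of the first
row makes that row positive, and orthogonality makes exactly half of the second row negative. -/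
theorem IsWeighingSet.isSwitchingIsomorphic_signedK₂ [Fintype V] {G : SignedGraph V}
    {S : Finset V} {m : ℕ} (h : G.IsWeighingSet S m) (hcard : Nat.card {v // v ∉ S} = m + 1)
    (hV : Fintype.card V = S.card + (m + 1)) (heven : Even m) (h4 : ¬4 ∣ m) (hS : 2 ≤ S.card) :
    G.IsSwitchingIsomorphic ((signedK₂ m).disjUnion K₁) := by
  classical
  obtain ⟨j, hj⟩ := h.exists_isolated hcard heven (Finset.card_pos.mp (by omega))
  have hj0 := fun u => (hj u j).mpr rfl
  have hiso := h.adjMatrix_isolated hj0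
  have hS2 : S.card = 2 := by
    by_contra hne
    obtain ⟨u, v, w, huv, huw, hvw⟩ := Fintype.two_lt_card_iff.mp
      (by rw [Fintype.card_coe]; omega : 2 < Fintype.card {v // v ∈ S})
    exact h4 (h.weighing.four_dvd hj huv huw hvw)
  obtain ⟨u₁, u₂, hu, hSu⟩ := Finset.card_eq_two.mp hS2
  have hu₁ : u₁ ∈ S := by simp [hSu]
  have hu₂ : u₂ ∈ S := by simp [hSu]
  have hB := h.weighing.deleteColumn hj0
  have hcard' : Fintype.card {i : {v // v ∉ S} // i ≠ j} = m := by
    have h1 : Fintype.card {i : {v // v ∉ S} // i ≠ j} = Fintype.card {v // v ∉ S} - 1 := by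
      rw [Fintype.card_subtype_compl, Fintype.card_subtype_eq]
    rw [h1, ← Nat.card_eq_fintype_card, hcard, Nat.add_sub_cancel]
  have hpm : ∀ (u : V) (_ : u ∈ S) (i : {i : {v // v ∉ S} // i ≠ j}),
      G.adjMatrix u i = 1 ∨ G.adjMatrix u i = -1 := by
    intro u hu i
    exact (G.adjMatrix_entry u i).resolve_left (mt (hj ⟨u, hu⟩ i).mp i.2)
  -- The vertices whose edge to u₂ is negative after switching.
  let p : {i : {v // v ∉ S} // i ≠ j} → Prop := fun i => G.adjMatrix u₁ i * G.adjMatrix u₂ i = -1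
  have hp : ∀ i : {i : {v // v ∉ S} // i ≠ j}, G.adjMatrix u₁ i * G.adjMatrix u₂ i = 1 - 2 * if p i then 1 else 0 := by
    intro i
    rcases hpm u₁ hu₁ i with h1 | h1 <;> rcases hpm u₂ hu₂ i with h2 | h2 <;>
      simp [p, h1, h2]
  have hpcard : Fintype.card {i // p i} = m / 2 := by
    have h1 := hB.orthogonal ⟨u₁, hu₁⟩ ⟨u₂, hu₂⟩ fun h => hu (congrArg Subtype.val h)
    have h2 : ∑ i : {i : {v // v ∉ S} // i ≠ j}, G.adjMatrix u₁ i * G.adjMatrix u₂ i = 0 := h1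
    rw [Finset.sum_congr rfl fun i _ => hp i, Finset.sum_sub_distrib, ← Finset.mul_sum,
      Finset.sum_boole, ← Fintype.card_subtype] at h2
    simp only [Finset.sum_const, Finset.card_univ, hcard', nsmul_eq_mul, mul_one] at h2
    omega
  obtain ⟨g, hg⟩ := exists_equiv_fin_iff_lt hcard' hpcard
  have hgS : ∀ b, ((g.symm b : {v // v ∉ S}) : V) ∉ S := fun b => (g.symm b).1.2
  have hgj : ∀ b, ((g.symm b : {v // v ∉ S}) : V) ≠ j := fun b hb => (g.symm b).2 (Subtype.ext hb)
  let f : (Fin 2 ⊕ Fin m) ⊕ Fin 1 → V :=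
    Sum.elim (Sum.elim (fun a => if a = 1 then u₂ else u₁) fun b => g.symm b) fun _ => j
  have hfS : ∀ a : Fin 2, (if a = 1 then u₂ else u₁) ∈ S := fun a => by
    split_ifs
    exacts [hu₂, hu₁]
  have hf : Function.Bijective f := by
    rw [Fintype.bijective_iff_injective_and_card]
    refine ⟨?_, ?_⟩
    · rintro ((a | a) | a) ((b | b) | b) hab
      · have hab' : (if a = 1 then u₂ else u₁) = (if b = 1 then u₂ else u₁) := hab
        congr 2
        split_ifs at hab' with h1 h2 h2
        · rw [h1, h2]
        · exact (hu hab'.symm).elim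
        · exact (hu hab').elim
        · omega
      · have hab' : (if a = 1 then u₂ else u₁) = (g.symm b : V) := hab
        exact (hgS b (hab' ▸ hfS a)).elim
      · have hab' : (if a = 1 then u₂ else u₁) = (j : V) := hab
        exact (j.2 (hab' ▸ hfS a)).elim
      · have hab' : (g.symm a : V) = (if b = 1 then u₂ else u₁) := hab
        exact (hgS a (hab' ▸ hfS b)).elim
      · exact congrArg (Sum.inl ∘ Sum.inr)
          (g.symm.injective (Subtype.ext (Subtype.ext hab)))
      · exact (hgj a hab).elim
      · have hab' : (j : V) = (if b = 1 then u₂ else u₁) := hab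
        exact (j.2 (hab' ▸ hfS b)).elim
      · exact (hgj b hab.symm).elim
      · exact congrArg Sum.inr (Subsingleton.elim a b)
    · simp only [Fintype.card_sum, Fintype.card_fin, hV, hS2]
      omega
  -- The isolated vertex gets the value 1, since its entry in the row of u₁ is 0 and not a sign.
  let d : V → ℤ := fun v => if v ∈ S ∨ v = j then 1 else G.adjMatrix u₁ v
  have hd : ∀ v, d v = 1 ∨ d v = -1 := by
    intro v
    by_cases hv : v ∈ S ∨ v = j
    · exact Or.inl (if_pos hv)
    · have h1 := hpm u₁ hu₁ ⟨⟨v, fun h => hv (Or.inl h)⟩,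
        fun h => hv (Or.inr (congrArg Subtype.val h))⟩
      rwa [← show d v = G.adjMatrix u₁ v from if_neg hv] at h1
  have hcross : ∀ (a : Fin 2) (b : Fin m),
      (if a = 1 ∧ (b : ℕ) < m / 2 then (-1 : ℤ) else 1) =
      d (if a = 1 then u₂ else u₁) * G.adjMatrix (if a = 1 then u₂ else u₁) (g.symm b) *
        d (g.symm b) := by
    intro a b
    have h1 : d (if a = 1 then u₂ else u₁) = 1 := if_pos (Or.inl (hfS a))
    have h2 : d (g.symm b) = G.adjMatrix u₁ (g.symm b) := if_neg (by
      rintro (h | h)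
      exacts [hgS b h, hgj b h])
    have h3 := hg (g.symm b)
    rw [Equiv.apply_symm_apply] at h3
    have h4 := hp (g.symm b)
    rw [h1, h2, one_mul]
    by_cases ha : a = 1
    · simp only [ha, true_and, if_true]
      rw [mul_comm, h4]
      simp only [h3]
      split_ifs <;> norm_num
    · simp only [ha, false_and, if_false]
      rcases hpm u₁ hu₁ (g.symm b) with h5 | h5 <;> rw [h5] <;> norm_num
  refine isSwitchingIsomorphic_of_equiv (Equiv.ofBijective f hf) d hd fun u v => ?_
  rw [adjMatrix_disjUnion, Equiv.ofBijective_apply, Equiv.ofBijective_apply]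
  rcases u with (a | a) | a <;> rcases v with (b | b) | b
  · rw [Matrix.fromBlocks_apply₁₁, adjMatrix_signedK₂_inl_inl]
    have h0 : G.adjMatrix (f (Sum.inl (Sum.inl a))) (f (Sum.inl (Sum.inl b))) = 0 :=
      h.inside _ _ (hfS a) (hfS b)
    rw [h0, mul_zero, zero_mul]
  · rw [Matrix.fromBlocks_apply₁₁, adjMatrix_signedK₂_inl_inr]
    exact hcross a b
  · have h0 : G.adjMatrix (f (Sum.inl (Sum.inl a))) (f (Sum.inr b)) = 0 := hiso _
    rw [h0, mul_zero, zero_mul]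
    rfl
  · rw [Matrix.fromBlocks_apply₁₁, adjMatrix_comm, adjMatrix_signedK₂_inl_inr, hcross b a,
      G.adjMatrix_comm (f _)]
    exact mul_right_comm _ _ _ |>.trans (by rw [mul_comm (d _) (d _), mul_right_comm]; rfl)
  · rw [Matrix.fromBlocks_apply₁₁, adjMatrix_signedK₂_inr_inr]
    have h0 : G.adjMatrix (f (Sum.inl (Sum.inr a))) (f (Sum.inl (Sum.inr b))) = 0 :=
      h.outside _ _ (hgS a) (hgS b)
    rw [h0, mul_zero, zero_mul]
  · have h0 : G.adjMatrix (f (Sum.inl (Sum.inr a))) (f (Sum.inr b)) = 0 := hiso _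
    rw [h0, mul_zero, zero_mul]
    rfl
  · have h0 : G.adjMatrix (f (Sum.inr a)) (f (Sum.inl (Sum.inl b))) = 0 :=
      (G.adjMatrix_comm _ _).trans (hiso _)
    rw [h0, mul_zero, zero_mul]
    rfl
  · have h0 : G.adjMatrix (f (Sum.inr a)) (f (Sum.inl (Sum.inr b))) = 0 :=
      (G.adjMatrix_comm _ _).trans (hiso _)
    rw [h0, mul_zero, zero_mul]
    rfl
  · have h0 : G.adjMatrix (f (Sum.inr a)) (f (Sum.inr b)) = 0 := hiso _
    rw [Matrix.fromBlocks_apply₂₂, h0, Subsingleton.elim a b, adjMatrix_self, mul_zero, zero_mul]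

end SignedGraph

theorem even_of_mem_paleyHadamardOrders {n : ℕ} (hn : n ∈ paleyHadamardOrders) : Even n := by
  have h2 : ∀ p, 1 ≤ p → Even (2 ^ p) := fun p hp => even_two.pow_of_ne_zero (by omega)
  rcases hn with ⟨p, hp, rfl⟩ | ⟨p, h, q, hp, hh, hq, rfl⟩ | ⟨p, q, hp, hq, hq4, rfl⟩ |
    ⟨q, hq, hq4, rfl⟩ | ⟨q, hq, hq4, rfl⟩
  · exact h2 p hp
  · exact (h2 p (by omega)).mul_right _
  · rw [mul_assoc]
    exact (h2 p (by omega)).mul_right _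
  · rw [Nat.even_iff]
    omega
  · exact even_two_mul _

theorem mainTheorem7 (s m : ℕ) (μ : ℝ) (hμ : μ ^ 2 = (m : ℝ)) (hs : s = m + 1) (h3 : 3 ≤ s) :
    (∃ (n : ℕ) (G : SignedGraph (Fin n)), G.IsMaximalBipartite μ s) ∧
    ∀ (V : Type*) [Fintype V] (G : SignedGraph V), G.IsMaximalBipartite μ s →
      ((2 ∣ m ∧ ¬ 4 ∣ m →
          G.IsSwitchingIsomorphic ((SignedGraph.signedK₂ m).disjUnion SignedGraph.K₁)) ∧
        (m ∈ paleyHadamardOrders →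
          ∃ R : SignedGraph (Fin (2 * m)), R.IsSRG (2 * m) m 0 0 0 ∧
            G.IsSwitchingIsomorphic (R.disjUnion SignedGraph.K₁)) ∧
        (IsPrimePow m ∧ Odd m →
          ∃ R : SignedGraph (Fin (2 * m + 2)), R.IsSRG (2 * m + 2) m 0 0 0 ∧
            G.IsSwitchingIsomorphic R)) := by
  classical
  subst hs
  have hm : 2 ≤ m := by omega
  have hμ0 : μ ≠ 0 := by
    rintro rfl
    have h0 : (m : ℝ) ≠ 0 := by positivity
    exact h0 (by rw [← hμ]; norm_num)
  refine ⟨SignedGraph.exists_isMaximalBipartite hμ hm hμ0, fun V _ G hG => ?_⟩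
  obtain ⟨S, hS, hcard, hV⟩ := hG.2.1.exists_isWeighingSet hG.1 hμ hm
  refine ⟨fun ⟨h2, h4⟩ => ?_, fun hmem => ?_, fun ⟨hpp, hodd⟩ => ?_⟩
  · obtain ⟨t, rfl⟩ := h2
    -- Copies of the Hadamard matrix of order 2 give two rows, so by maximality |S| ≥ 2.
    obtain ⟨B, hB⟩ := isHadamardOrder_two.exists_partialWeighing (t := t) rfl
    exact hS.isSwitchingIsomorphic_signedK₂ hcard hV (even_two_mul t) h4
      (hG.card_le hμ hμ0 hV two_pos hB)
  · obtain ⟨B, hB⟩ := (isHadamardOrder_of_mem hmem).exists_partialWeighing (mul_one m)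
    exact hS.exists_isSRG_disjUnion hm hcard hV (even_of_mem_paleyHadamardOrders hmem)
      (hG.card_le hμ hμ0 hV (by omega) hB)
  -- The conference matrix attains the rank bound, so |S| = m + 1.
  · obtain ⟨B, hB⟩ := exists_partialWeighing_of_odd_primePow hpp hodd
    have h1 := hG.card_le hμ hμ0 hV (Nat.succ_pos m) hB
    have h2 := hS.weighing.card_le (by omega)
    rw [Fintype.card_coe, ← Nat.card_eq_fintype_card, hcard] at h2
    exact hS.exists_isSRG hm hcard hV (le_antisymm h2 h1)
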